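/- Let $\alpha\ge 0$, and let $(a_k)_{k\ge1}$ and $(b_k)_{k\ge1}$ be two independent centered stationary Gaussian processes with the same correlation function $\mathbb E[a_ka_l]=\mathbb E[b_kb_l]=\cos((k-l)\alpha)$. For $n\ge1$ put $$f_n(t)=\frac1{\sqrt n}\sum_{k=1}^n\bigl(a_k\cos(kt)+b_k\sin(kt)\bigr),$$ and let $\mathcal N(f_n,[0,2\pi])$ be the number of zeros of $f_n$ in $[0,2\pi]$. For $0<x<\pi$ let $$\ell^\alpha(x)=\frac1{4\pi^2}\int_{[0,2\pi]^2}\sqrt{1+|g_x^\alpha(s,u)|^2}\,ds\,du,$$ $$g_x^\alpha(s,u)=\frac{\sin(x)\,\sin\left(\frac{s-\alpha}2\right)\sin\left(\frac{s+\alpha}2\right)}{\sin^2\left(\frac{u-x}2\right)\sin^2\left(\frac{s+\alpha}2\right)+\sin^2\left(\frac{u+x}2\right)\sin^2\left(\frac{s-\alpha}2\right)}.$$ Fix $x\in(0,\pi)$ and let $(\varphi(n))_{n\ge1}$ be a strictly increasing sequence of positive integers such that $\varphi(n)\alpha \bmod \pi$ (the representative in $[0,\pi)$) converges to $x$ as $n\to\infty$.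 Then $\mathcal N(f_m,[0,2\pi])$ has finite expectation for every $m\ge1$, the integral defining $\ell^\alpha(x)$ converges, and $$\lim_{n\to\infty}\left|\frac{\mathbb E\left[\mathcal N(f_{\varphi(n)},[0,2\pi])\right]}{\varphi(n)}-\ell^\alpha(x)\right|=0.$$ -/

import Mathlib

open MeasureTheory ProbabilityTheory Filter Topology
open scoped ENNReal

/-- `(a k)_{k ≥ 1}` is a centered stationary Gaussian process on `(Ω, P)` with correlation function
`k ↦ cos (k α)`, that is, with spectral measure `(δ_α + δ_{-α}) / 2`.
The value of `a` at the index `0` plays no role. -/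
structure IsCosineGaussian {Ω : Type*} [MeasurableSpace Ω] (P : Measure Ω) (α : ℝ)
    (a : ℕ → Ω → ℝ) : Prop where
  gaussian : IsGaussianProcess (fun k : ℕ => a (k + 1)) P
  centered : ∀ k : ℕ, 1 ≤ k → ∫ ω, a k ω ∂P = 0
  correlation : ∀ k l : ℕ, 1 ≤ k → 1 ≤ l →
    ∫ ω, a k ω * a l ω ∂P = Real.cos (((k : ℝ) - (l : ℝ)) * α)

/-- The trigonometric polynomial `n^{-1/2} ∑_{k=1}^n (a_k cos (k t) + b_k sin (k t))`. -/
noncomputable def trigPoly (a b : ℕ → ℝ) (n : ℕ) (t : ℝ) : ℝ :=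
  1 / Real.sqrt (n : ℝ) *
    ∑ k ∈ Finset.Icc 1 n, (a k * Real.cos ((k : ℝ) * t) + b k * Real.sin ((k : ℝ) * t))

/-- The number (possibly `∞`) of zeros of `f` in the interval `[0, 2π]`. -/
noncomputable def zeroCount (f : ℝ → ℝ) : ℝ≥0∞ :=
  (({t : ℝ | t ∈ Set.Icc 0 (2 * Real.pi) ∧ f t = 0}.encard : ℕ∞) : ℝ≥0∞)

/-- The random number of zeros in `[0, 2π]` of the random trigonometric polynomial of degree `n`
with coefficient processes `a` and `b`. -/
noncomputable def randomZeroCount {Ω : Type*} (a b : ℕ → Ω → ℝ) (n : ℕ) (ω : Ω) : ℝ≥0∞ :=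
  zeroCount (trigPoly (fun k => a k ω) (fun k => b k ω) n)

/-- The expected number of zeros in `[0, 2π]`, an element of `[0, ∞]`. -/
noncomputable def expectedZeros {Ω : Type*} [MeasurableSpace Ω] (P : Measure Ω)
    (a b : ℕ → Ω → ℝ) (n : ℕ) : ℝ≥0∞ :=
  ∫⁻ ω, randomZeroCount a b n ω ∂P

/-- The function `g_x^α (s, u)`. -/
noncomputable def gFun (α x s u : ℝ) : ℝ :=
  Real.sin x * Real.sin ((s - α) / 2) * Real.sin ((s + α) / 2) /
    (Real.sin ((u - x) / 2) ^ 2 * Real.sin ((s + α) / 2) ^ 2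
      + Real.sin ((u + x) / 2) ^ 2 * Real.sin ((s - α) / 2) ^ 2)

/-- The integrand `√(1 + |g_x^α (s, u)|²)` of `ℓ^α (x)`. -/
noncomputable def ellIntegrand (α x : ℝ) (p : ℝ × ℝ) : ℝ :=
  Real.sqrt (1 + |gFun α x p.1 p.2| ^ 2)

/-- The function `ℓ^α (x) = (4 π²)⁻¹ ∫_{[0, 2π]²} √(1 + |g_x^α (s, u)|²) ds du`. -/
noncomputable def ell (α x : ℝ) : ℝ :=
  1 / (4 * Real.pi ^ 2) *
    ∫ p in Set.Icc (0 : ℝ) (2 * Real.pi) ×ˢ Set.Icc (0 : ℝ) (2 * Real.pi), ellIntegrand α x p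

/-! A process with correlation `cos ((k - l) α)` is driven by two variables: almost surely `a_k = ξ
cos kα + ξ' sin kα` with `ξ`, `ξ'` independent standard Gaussians (`IsCosineGaussian.ae_eq`,
`IsCosineGaussian.map_coeffVec`). This needs `sin α ≠ 0`, which is forced when `φ(n) α` converges
modulo `π` to a point of `(0, π)`. So `f_n` is a standard Gaussian combination of four fixed
functions, and its expected number of zeros is `1/π` times the length of their curve projected to
the unit sphere (`lintegral_encard_zeros_gaussian`).

Multiplying the curve by the scalar `2 sin ((t + α)/2) sin ((t - α)/2)` changes its projection at
most by a sign away from the zeros of the scalar, and sums the Dirichlet kernels. The result is `M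
e₋ + P e₊`, with `M = ampMinus`, `P = ampPlus` and `e₋`, `e₊` of equal length, rotating at speed `(n
+ 1)/2` in two orthogonal planes. The squared speed on the sphere is therefore the sum of the
squares of `(n + 1)/2` and of the angular velocity of `(M, P)`, and the density of zeros is `n/(2π)
√((1 + 1/n)² + ω²)` with `ω = angularSpeed`.

The limit is a two-scale average. Take `t - α` near `s` with `n (t - α) ≡ v` modulo `2π`. Then `n (t
+ α)/2 ≡ v/2 + nα` modulo `π`, which tends to `v/2 + x`, and `ω²` tends to the square of `g` at `(s
+ α, v + x)`; periodicity removes the two shifts. Dominated convergence must handle `t = ±α`, where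
`M² + P²` vanishes. There the numerator of `ω` vanishes to second order, and interpolation yields
the integrable majorant `|sin (s/2)|^(-1/2) |sin (v/2)|^(-1/2)` up to constants
(`sin_sq_mul_abs_angularSpeed_le`). A partition of unity isolates the singularity at `α`; the one at
`-α` follows from the symmetry `(α, x) ↦ (-α, -x)`. -/

/-! ### Area formula with multiplicity -/

/-- The one-dimensional area formula with multiplicity (Banach indicatrix). -/
theorem lintegral_encard_fiber_mul {E : Set ℝ} (hE : MeasurableSet E) {h h' : ℝ → ℝ}
    (hd : ∀ t ∈ E, HasStrictDerivAt h (h' t) t) {w : ℝ → ℝ≥0∞} (hw : Measurable w) :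
    ∫⁻ y, (({t : ℝ | t ∈ E ∧ h t = y}.encard : ℕ∞) : ℝ≥0∞) * w y =
      ∫⁻ t in E, ENNReal.ofReal |h' t| * w (h t) := by
  -- `deriv h` is measurable for every `h`, whereas nothing is known about `h'` off `E`.
  have hder : ∀ t ∈ E, h' t = deriv h t := fun t ht => ((hd t ht).hasDerivAt.deriv).symm
  set V : Set ℝ := E ∩ {t | deriv h t ≠ 0} with hV
  have hVm : MeasurableSet V :=
    hE.inter ((measurable_deriv h) (measurableSet_singleton 0).compl)
  classical
  -- Rational intervals on which `h` is injective at non-critical points; the inverse function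
  -- theorem shows that they cover `V`.
  let U : ℚ × ℚ → Set ℝ := fun p =>
    if Set.InjOn h (Set.Ioo (p.1 : ℝ) p.2 ∩ V) then Set.Ioo (p.1 : ℝ) p.2 ∩ V else ∅
  have hUm : ∀ p, MeasurableSet (U p) := by
    intro p
    simp only [U]
    split_ifs
    · exact measurableSet_Ioo.inter hVm
    · exact MeasurableSet.empty
  have hUi : ∀ p, Set.InjOn h (U p) := by
    intro p
    simp only [U]
    split_ifs with hp
    · exact hp
    · exact Set.injOn_empty h
  have hUV : ∀ p, U p ⊆ V := by
    intro p
    simp only [U]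
    split_ifs
    · exact Set.inter_subset_right
    · exact Set.empty_subset _
  have hcov : ⋃ p, U p = V := by
    refine Set.Subset.antisymm (Set.iUnion_subset hUV) fun t ht => ?_
    have hs := hd t ht.1
    have hne : h' t ≠ 0 := by rw [hder t ht.1]; exact ht.2
    have he := hs.hasStrictFDerivAt_equiv hne
    set e := he.toOpenPartialHomeomorph h
    have hsrc : e.source ∈ 𝓝 t := e.open_source.mem_nhds he.mem_toOpenPartialHomeomorph_source
    obtain ⟨l, u, htlu, hlu⟩ := mem_nhds_iff_exists_Ioo_subset.1 hsrc
    obtain ⟨q, hq1, hq2⟩ := exists_rat_btwn htlu.1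
    obtain ⟨r, hr1, hr2⟩ := exists_rat_btwn htlu.2
    refine Set.mem_iUnion.2 ⟨(q, r), ?_⟩
    have hinj : Set.InjOn h (Set.Ioo (q : ℝ) r ∩ V) := by
      refine Set.InjOn.mono ?_ e.injOn
      exact fun s hs => hlu ⟨hq1.trans hs.1.1, hs.1.2.trans hr2⟩
    simp only [U, if_pos hinj]
    exact ⟨⟨hq2, hr1⟩, ht⟩
  let W : ℕ → Set ℝ := fun k => U ((Denumerable.eqv (ℚ × ℚ)).symm k)
  let D : ℕ → Set ℝ := disjointed W
  have hDm : ∀ k, MeasurableSet (D k) := MeasurableSet.disjointed fun k => hUm _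
  have hDW : ∀ k, D k ⊆ W k := disjointed_subset W
  have hDi : ∀ k, Set.InjOn h (D k) := fun k => (hUi _).mono (hDW k)
  have hDV : ⋃ k, D k = V := by
    rw [iUnion_disjointed, ← hcov]
    exact (Denumerable.eqv (ℚ × ℚ)).symm.surjective.iUnion_comp U
  have hDsub : ∀ k, D k ⊆ E := fun k t ht =>
    (hDV ▸ Set.mem_iUnion.2 ⟨k, ht⟩ : t ∈ V).1
  have hcount : ∀ y, (({t : ℝ | t ∈ V ∧ h t = y}.encard : ℕ∞) : ℝ≥0∞) =
      ∑' k, (h '' D k).indicator (fun _ => (1 : ℝ≥0∞)) y := by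
    intro y
    have hsub : ∀ k, (D k ∩ h ⁻¹' {y}).Subsingleton := fun k s hs t ht =>
      hDi k hs.1 ht.1 (hs.2.trans ht.2.symm)
    have hU : {t : ℝ | t ∈ V ∧ h t = y} = ⋃ k, D k ∩ h ⁻¹' {y} := by
      rw [← Set.iUnion_inter, hDV]; rfl
    have hm : ∀ k, MeasurableSet (D k ∩ h ⁻¹' {y}) := fun k => (hsub k).measurableSet
    rw [← Measure.count_apply (by rw [hU]; exact MeasurableSet.iUnion hm), hU,
      measure_iUnion (fun i j hij => ((disjoint_disjointed W hij).mono Set.inter_subset_left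
        Set.inter_subset_left)) hm]
    refine tsum_congr fun k => ?_
    by_cases hy : y ∈ h '' D k
    · obtain ⟨t, ht, rfl⟩ := hy
      rw [Set.indicator_of_mem (Set.mem_image_of_mem h ht),
        (hsub k).eq_singleton_of_mem ⟨ht, rfl⟩, Measure.count_singleton]
    · rw [Set.indicator_of_notMem hy]
      have : D k ∩ h ⁻¹' {y} = ∅ := by
        ext t
        simp only [Set.mem_inter_iff, Set.mem_preimage, Set.mem_singleton_iff,
          Set.mem_empty_iff_false, iff_false, not_and]
        exact fun ht hty => hy ⟨t, ht, hty⟩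
      rw [this, measure_empty]
  -- Sard in dimension one: the critical values form a null set, so critical points affect neither
  -- side.
  have hcrit : volume (h '' (E ∩ {t | deriv h t = 0})) = 0 := by
    refine addHaar_image_eq_zero_of_det_fderivWithin_eq_zero volume
      (f' := fun t => (ContinuousLinearMap.smulRight (1 : ℝ →L[ℝ] ℝ) (h' t))) ?_ ?_
    · intro t ht
      exact (hd t ht.1).hasDerivAt.hasFDerivAt.hasFDerivWithinAt
    · intro t ht
      have : h' t = 0 := by rw [hder t ht.1]; exact ht.2
      simp [this]
  have hae : ∀ᵐ y ∂(volume : Measure ℝ), {t : ℝ | t ∈ E ∧ h t = y} = {t : ℝ | t ∈ V ∧ h t = y} := by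
    filter_upwards [measure_eq_zero_iff_ae_notMem.1 hcrit] with y hy
    ext t
    constructor
    · rintro ⟨ht, hty⟩
      exact ⟨⟨ht, fun h0 => hy ⟨t, ⟨ht, h0⟩, hty⟩⟩, hty⟩
    · rintro ⟨ht, hty⟩
      exact ⟨ht.1, hty⟩
  have himm : ∀ k, MeasurableSet (h '' D k) := fun k =>
    measurable_image_of_fderivWithin (hDm k)
      (fun t ht => (hd t (hDsub k ht)).hasDerivAt.hasFDerivAt.hasFDerivWithinAt) (hDi k)
  calc ∫⁻ y, (({t : ℝ | t ∈ E ∧ h t = y}.encard : ℕ∞) : ℝ≥0∞) * w y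
      = ∫⁻ y, ∑' k, (h '' D k).indicator w y := by
        refine lintegral_congr_ae ?_
        filter_upwards [hae] with y hy
        rw [hy, hcount, ← ENNReal.tsum_mul_right]
        refine tsum_congr fun k => ?_
        by_cases hyk : y ∈ h '' D k <;> simp [Set.indicator, hyk]
    _ = ∑' k, ∫⁻ y in h '' D k, w y := by
        rw [lintegral_tsum fun k => (hw.indicator (himm k)).aemeasurable]
        exact tsum_congr fun k => lintegral_indicator (himm k) w
    _ = ∑' k, ∫⁻ t in D k, ENNReal.ofReal |h' t| * w (h t) :=
        tsum_congr fun k => lintegral_image_eq_lintegral_abs_deriv_mul (hDm k)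
          (fun t ht => (hd t (hDsub k ht)).hasDerivAt.hasDerivWithinAt) (hDi k) w
    _ = ∫⁻ t in V, ENNReal.ofReal |h' t| * w (h t) := by
        rw [← hDV, lintegral_iUnion hDm (disjoint_disjointed W)]
    _ = ∫⁻ t in E, ENNReal.ofReal |h' t| * w (h t) := by
        have hB : MeasurableSet {t | deriv h t ≠ 0} :=
          (measurable_deriv h) (measurableSet_singleton 0).compl
        rw [← lintegral_inter_add_sdiff _ E hB, setLIntegral_eq_zero (hE.diff hB), add_zero]
        rintro t ⟨htE, ht⟩
        have : deriv h t = 0 := not_not.1 ht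
        simp [hder t htE, this]

/-! ### Measurability of the number of zeros -/

/-- Distinct points of a finite set are separated by disjoint rational intervals. This turns a lower
bound on the cardinality into a countable union of hitting events. -/
theorem natCast_le_encard_iff_exists_rat (S : Set ℝ) (m : ℕ) :
    (m : ℕ∞) ≤ S.encard ↔ ∃ I : Fin m → ℚ × ℚ,
      Pairwise (fun i j => Disjoint (Set.Icc ((I i).1 : ℝ) (I i).2) (Set.Icc ((I j).1 : ℝ) (I j).2)) ∧
      ∀ j, (S ∩ Set.Icc ((I j).1 : ℝ) (I j).2).Nonempty := by
  constructor
  · intro hm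
    obtain ⟨T, hTS, hT⟩ := Set.exists_subset_encard_eq hm
    have hTf : T.Finite := Set.finite_of_encard_eq_coe hT
    obtain ⟨U, hU, hdisj⟩ := hTf.t2_separation
    have hcard : Nat.card T = m := by
      have := hTf.encard_eq_coe_toFinset_card
      rw [hT] at this
      rw [Nat.card_coe_set_eq, Set.ncard, hT]; rfl
    have : Finite T := hTf
    let e : T ≃ Fin m := (Finite.equivFinOfCardEq hcard)
    have hex : ∀ x : ℝ, ∃ p : ℚ × ℚ, x ∈ Set.Icc (p.1 : ℝ) p.2 ∧ Set.Icc (p.1 : ℝ) p.2 ⊆ U x := by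
      intro x
      obtain ⟨l, u, hx, hlu⟩ := mem_nhds_iff_exists_Ioo_subset.1 ((hU x).2.mem_nhds (hU x).1)
      obtain ⟨q, hq1, hq2⟩ := exists_rat_btwn hx.1
      obtain ⟨r, hr1, hr2⟩ := exists_rat_btwn hx.2
      exact ⟨(q, r), ⟨hq2.le, hr1.le⟩, fun y hy => hlu ⟨hq1.trans_le hy.1, hy.2.trans_lt hr2⟩⟩
    choose p hp1 hp2 using hex
    refine ⟨fun j => p (e.symm j), fun i j hij => ?_, fun j => ⟨e.symm j, hTS (e.symm j).2, hp1 _⟩⟩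
    refine (hdisj (e.symm i).2 (e.symm j).2 ?_).mono (hp2 _) (hp2 _)
    exact fun h => hij (e.symm.injective (Subtype.ext h))
  · rintro ⟨I, hI, hne⟩
    choose f hf using hne
    have hinj : Function.Injective f := by
      intro i j hij
      by_contra hne
      exact Set.disjoint_left.1 (hI hne) (hf i).2 (hij ▸ (hf j).2)
    calc (m : ℕ∞) = (Set.range f).encard := by
          rw [← Set.image_univ, hinj.encard_image]; simp
      _ ≤ S.encard := Set.encard_le_encard (Set.range_subset_iff.2 fun j => (hf j).1)

/-- Having a zero in a given compact set is a closed condition on the parameter: it is the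
projection of a closed set along a compact factor. -/
theorem measurable_zeroCount {G : Type*} [TopologicalSpace G] [MeasurableSpace G]
    [OpensMeasurableSpace G] {F : G → ℝ → ℝ} (hF : Continuous (Function.uncurry F)) :
    Measurable fun g => zeroCount (F g) := by
  classical
  let Z : G → Set ℝ := fun g => {t : ℝ | t ∈ Set.Icc 0 (2 * Real.pi) ∧ F g t = 0}
  have hhit : ∀ p : ℚ × ℚ, MeasurableSet {g | (Z g ∩ Set.Icc (p.1 : ℝ) p.2).Nonempty} := by
    intro p
    let K : Set ℝ := Set.Icc 0 (2 * Real.pi) ∩ Set.Icc (p.1 : ℝ) p.2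
    have hK : IsCompact K := isCompact_Icc.inter isCompact_Icc
    have : CompactSpace K := isCompact_iff_compactSpace.1 hK
    have hc : IsClosed {q : G × K | F q.1 q.2 = 0} :=
      isClosed_eq (hF.comp (by fun_prop : Continuous fun q : G × K => (q.1, (q.2 : ℝ))))
        continuous_const
    have himg := isClosedMap_fst_of_compactSpace _ hc
    convert! himg.measurableSet using 1
    ext g
    constructor
    · rintro ⟨t, ht, htp⟩
      exact ⟨(g, ⟨t, ht.1, htp⟩), ht.2, rfl⟩
    · rintro ⟨⟨g', t⟩, ht, rfl⟩
      exact ⟨t, ⟨t.2.1, ht⟩, t.2.2⟩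
  have hset : ∀ m : ℕ, MeasurableSet {g | (m : ℕ∞) ≤ (Z g).encard} := by
    intro m
    simp_rw [natCast_le_encard_iff_exists_rat]
    rw [Set.ofPred_exists]
    refine MeasurableSet.iUnion fun I => ?_
    rw [Set.ofPred_and, Set.ofPred_forall]
    exact (MeasurableSet.const _).inter (MeasurableSet.iInter fun j => hhit (I j))
  have heq : (fun g => zeroCount (F g)) =
      fun g => ⨆ m : ℕ, {g | (m : ℕ∞) ≤ (Z g).encard}.indicator (fun _ => (m : ℝ≥0∞)) g := by
    funext g
    refine le_antisymm ?_ (iSup_le fun m => ?_)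
    · change (((Z g).encard : ℕ∞) : ℝ≥0∞) ≤ _
      have key : ∀ m : ℕ, (m : ℕ∞) ≤ (Z g).encard → (m : ℝ≥0∞) ≤
          ⨆ m : ℕ, {g | (m : ℕ∞) ≤ (Z g).encard}.indicator (fun _ => (m : ℝ≥0∞)) g := by
        intro m hm
        refine le_trans ?_ (le_iSup _ m)
        rw [Set.indicator_of_mem (show g ∈ {g | (m : ℕ∞) ≤ (Z g).encard} from hm)]
      rcases eq_or_ne (Z g).encard ⊤ with htop | htop
      · rw [htop, ENat.toENNReal_top, ← ENNReal.iSup_natCast]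
        exact iSup_le fun m => key m (by simp [htop])
      · obtain ⟨m, hm⟩ := ENat.ne_top_iff_exists.1 htop
        rw [← hm, ENat.toENNReal_coe]
        exact key m hm.le
    · by_cases hg : (m : ℕ∞) ≤ (Z g).encard
      · rw [Set.indicator_of_mem (show g ∈ {g | (m : ℕ∞) ≤ (Z g).encard} from hg)]
        rw [← ENat.toENNReal_coe]
        exact ENat.toENNReal_le.2 hg
      · rw [Set.indicator_of_notMem (show g ∉ {g | (m : ℕ∞) ≤ (Z g).encard} from hg)]
        exact zero_le
  rw [heq]
  exact Measurable.iSup fun m => measurable_const.indicator (hset m)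

/-! ### Deterministic bound on the number of zeros -/

-- With `z = exp (i t)`, the sum times `z ^ n` is a polynomial in `z` of degree at most `2 n`. Since
-- `t ↦ z` is injective only on `[0, 2π)`, the endpoint `2π` accounts for the extra `1`.
open Polynomial in
theorem zeroCount_trigPoly_le (a b : ℕ → ℝ) (n : ℕ)
    (hab : ∃ k ∈ Finset.Icc 1 n, a k ≠ 0 ∨ b k ≠ 0) :
    zeroCount (trigPoly a b n) ≤ 2 * n + 1 := by
  obtain ⟨k₀, hk₀, hne⟩ := hab
  have hk₀' := Finset.mem_Icc.1 hk₀
  have hn : 1 ≤ n := hk₀'.1.trans hk₀'.2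
  let p : ℂ[X] := ∑ k ∈ Finset.Icc 1 n,
    (C (((a k : ℂ) - Complex.I * b k) / 2) * X ^ (n + k) +
      C (((a k : ℂ) + Complex.I * b k) / 2) * X ^ (n - k))
  have hcoeff : p.coeff (n + k₀) = ((a k₀ : ℂ) - Complex.I * b k₀) / 2 := by
    simp only [p, finsetSum_coeff, coeff_add, coeff_C_mul, coeff_X_pow]
    rw [Finset.sum_eq_single_of_mem k₀ hk₀]
    · have : n + k₀ ≠ n - k₀ := by omega
      simp [this]
    · intro k hk hkk
      have h1 : n + k₀ ≠ n + k := by omega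
      have h2 : n + k₀ ≠ n - k := by omega
      rw [if_neg h1, if_neg h2]; simp
  have hp0 : p ≠ 0 := by
    intro h0
    rw [h0, coeff_zero] at hcoeff
    have h1 := congrArg Complex.re hcoeff
    have h2 := congrArg Complex.im hcoeff
    simp only [Complex.zero_re, Complex.zero_im] at h1 h2
    simp at h1 h2
    rcases hne with h | h
    · exact h (by linarith)
    · exact h (by linarith)
  have hdeg : p.natDegree ≤ 2 * n := by
    refine natDegree_sum_le_of_forall_le _ _ fun k hk => ?_
    have hk' := Finset.mem_Icc.1 hk
    refine natDegree_add_le_of_degree_le ((natDegree_C_mul_X_pow_le _ _).trans (by omega))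
      ((natDegree_C_mul_X_pow_le _ _).trans (by omega))
  have heval : ∀ t : ℝ, p.eval (Complex.exp (t * Complex.I)) =
      Complex.exp (n * (t * Complex.I)) *
        ((∑ k ∈ Finset.Icc 1 n,
          (a k * Real.cos ((k : ℝ) * t) + b k * Real.sin ((k : ℝ) * t)) : ℝ) : ℂ) := by
    intro t
    simp only [p, eval_finsetSum, eval_add, eval_mul, eval_C, eval_pow, eval_X]
    rw [Complex.ofReal_sum, Finset.mul_sum]
    refine Finset.sum_congr rfl fun k hk => ?_
    have hk' := Finset.mem_Icc.1 hk
    have e1 : Complex.exp (t * Complex.I) ^ (n + k) =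
        Complex.exp (n * (t * Complex.I)) * Complex.exp (k * t * Complex.I) := by
      rw [← Complex.exp_nat_mul, ← Complex.exp_add]; congr 1; push_cast; ring
    have e2 : Complex.exp (t * Complex.I) ^ (n - k) =
        Complex.exp (n * (t * Complex.I)) * Complex.exp (-(k * t) * Complex.I) := by
      rw [← Complex.exp_nat_mul, ← Complex.exp_add]; congr 1; push_cast [hk'.2]; ring
    rw [e1, e2, Complex.exp_mul_I, Complex.exp_mul_I, Complex.cos_neg, Complex.sin_neg]
    push_cast
    linear_combination (-(b k : ℂ) * Complex.exp (n * (t * Complex.I)) *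
      Complex.sin (k * t)) * Complex.I_sq
  have hsub : {t : ℝ | t ∈ Set.Icc 0 (2 * Real.pi) ∧ trigPoly a b n t = 0} ⊆
      insert (2 * Real.pi) (Set.Ico 0 (2 * Real.pi) ∩
        (fun t : ℝ => Complex.exp (t * Complex.I)) ⁻¹' (p.roots.toFinset : Set ℂ)) := by
    rintro t ⟨ht, ht0⟩
    rcases ht.2.eq_or_lt with h2 | h2
    · exact Or.inl h2
    · refine Or.inr ⟨⟨ht.1, h2⟩, ?_⟩
      have hsq : 1 / Real.sqrt (n : ℝ) ≠ 0 := by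
        have : (0 : ℝ) < n := by exact_mod_cast hn
        positivity
      have hs := (mul_eq_zero.1 ht0).resolve_left hsq
      simp only [Set.mem_preimage, Finset.mem_coe, Multiset.mem_toFinset, mem_roots hp0, IsRoot.def]
      rw [heval, hs]; simp
  have hinj : Set.InjOn (fun t : ℝ => Complex.exp (t * Complex.I)) (Set.Ico 0 (2 * Real.pi)) := by
    intro s hs t ht hst
    obtain ⟨j, hj⟩ := Complex.exp_eq_exp_iff_exists_int.1 hst
    have hj' : s = t + j * (2 * Real.pi) := by
      have h := congrArg Complex.im hj
      simpa using h
    have hpi := Real.pi_pos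
    have h1 : (j : ℝ) < 1 := by
      by_contra hcon
      push Not at hcon
      nlinarith [hs.2, ht.1]
    have h2 : (-1 : ℝ) < j := by
      by_contra hcon
      push Not at hcon
      nlinarith [hs.1, ht.2]
    have : j = 0 := by
      have h1' : j < 1 := by exact_mod_cast h1
      have h2' : -1 < j := by exact_mod_cast h2
      omega
    simpa [this] using hj'
  have hle : ({t : ℝ | t ∈ Set.Icc 0 (2 * Real.pi) ∧ trigPoly a b n t = 0}).encard ≤
      ((2 * n + 1 : ℕ) : ℕ∞) := by
    refine (Set.encard_le_encard hsub).trans ((Set.encard_insert_le _ _).trans ?_)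
    push_cast
    gcongr
    calc _ = ((fun t : ℝ => Complex.exp (t * Complex.I)) '' (Set.Ico 0 (2 * Real.pi) ∩
        (fun t : ℝ => Complex.exp (t * Complex.I)) ⁻¹' (p.roots.toFinset : Set ℂ))).encard :=
          ((hinj.mono Set.inter_subset_left).encard_image).symm
      _ ≤ (p.roots.toFinset : Set ℂ).encard := Set.encard_le_encard (by
          rintro _ ⟨t, ht, rfl⟩; exact ht.2)
      _ = (p.roots.toFinset.card : ℕ∞) := Set.encard_coe_eq_coe_finsetCard _
      _ ≤ ((2 * n : ℕ) : ℕ∞) := by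
          exact_mod_cast (Multiset.toFinset_card_le _).trans ((card_roots' p).trans hdeg)
      _ = _ := by push_cast; rfl
  have := ENat.toENNReal_le.2 hle
  simpa [zeroCount] using this

/-! ### Gaussian integrals -/

open scoped NNReal

theorem lintegral_abs_gaussianReal_one :
    ∫⁻ x, ENNReal.ofReal |x| ∂(gaussianReal 0 1) = ENNReal.ofReal √(2 / Real.pi) := by
  have hint : Integrable (fun x : ℝ => |x|) (gaussianReal 0 1) :=
    (IsGaussian.integrable_fun_id (μ := gaussianReal 0 1)).abs
  rw [← ofReal_integral_eq_lintegral_ofReal hint (ae_of_all _ fun x => abs_nonneg x),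
    integral_gaussianReal_eq_integral_smul one_ne_zero]
  congr 1
  have h1 : ∀ x : ℝ, gaussianPDFReal 0 1 x • |x| =
      (fun y => (√(2 * Real.pi))⁻¹ * (y * Real.exp (-(1 / 2) * y ^ 2))) |x| := by
    intro x
    simp only [gaussianPDFReal, smul_eq_mul, sq_abs]
    have : -(x - 0) ^ 2 / (2 * ((1 : ℝ≥0) : ℝ)) = -(1 / 2) * x ^ 2 := by
      push_cast; ring
    rw [this]
    push_cast
    rw [mul_one]; ring
  simp_rw [h1]
  rw [integral_comp_abs (f := fun y => (√(2 * Real.pi))⁻¹ * (y * Real.exp (-(1 / 2) * y ^ 2))),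
    integral_const_mul]
  have h2 : ∫ y in Set.Ioi (0 : ℝ), y * Real.exp (-(1 / 2) * y ^ 2) = 1 := by
    have h := integral_mul_cexp_neg_mul_sq (b := (1 / 2 : ℂ)) (by norm_num)
    have h3 : ∀ y : ℝ, (y : ℂ) * Complex.exp (-(1 / 2) * (y : ℂ) ^ 2) =
        ((y * Real.exp (-(1 / 2) * y ^ 2) : ℝ) : ℂ) := by
      intro y; push_cast; rfl
    simp_rw [h3] at h
    rw [integral_complex_ofReal] at h
    have h4 : ((2 : ℂ) * (1 / 2))⁻¹ = ((1 : ℝ) : ℂ) := by norm_num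
    rw [h4] at h
    exact_mod_cast h
  rw [h2, mul_one, show (2 : ℝ) / Real.pi = 2 ^ 2 / (2 * Real.pi) by field_simp,
    Real.sqrt_div (by positivity), Real.sqrt_sq (by norm_num)]
  rfl

theorem lintegral_abs_gaussianReal (v : ℝ≥0) :
    ∫⁻ x, ENNReal.ofReal |x| ∂(gaussianReal 0 v) = ENNReal.ofReal √(2 * v / Real.pi) := by
  have hmap : gaussianReal 0 v = (gaussianReal 0 1).map (fun x => √(v : ℝ) * x) := by
    rw [gaussianReal_map_const_mul]
    congr 1
    · simp
    · ext; simp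
  rw [hmap, lintegral_map (by fun_prop) (by fun_prop)]
  simp_rw [abs_mul, ENNReal.ofReal_mul (abs_nonneg (√(v : ℝ)))]
  rw [lintegral_const_mul _ (by fun_prop), lintegral_abs_gaussianReal_one,
    ← ENNReal.ofReal_mul (abs_nonneg _), abs_of_nonneg (Real.sqrt_nonneg _),
    ← Real.sqrt_mul v.coe_nonneg]
  congr 2
  ring

theorem gaussianPDFReal_mul_gaussianPDFReal_one {v : ℝ≥0} (hv : v ≠ 0) (x : ℝ) :
    gaussianPDFReal 0 v x * gaussianPDFReal 0 1 x =
      (√(2 * Real.pi * (1 + v)))⁻¹ * gaussianPDFReal 0 (v / (1 + v)) x := by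
  have hv' : (0 : ℝ) < v := by positivity
  simp only [gaussianPDFReal]
  have e : ∀ a b c d : ℝ, (a * b) * (c * d) = (a * c) * (b * d) := by intros; ring
  rw [e, ← Real.exp_add, ← mul_assoc, ← mul_inv, ← mul_inv, ← Real.sqrt_mul (by positivity),
    ← Real.sqrt_mul (by positivity)]
  have e1 : 2 * Real.pi * (v : ℝ) * (2 * Real.pi * ((1 : ℝ≥0) : ℝ)) =
      2 * Real.pi * (1 + (v : ℝ)) * (2 * Real.pi * ((v / (1 + v) : ℝ≥0) : ℝ)) := by
    push_cast; field_simp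
  rw [e1]
  congr 2
  push_cast; field_simp; ring

/-- Precisions add: `1/v + 1` is the inverse of `v / (1 + v)`. For `v = 0` both measures are Dirac
masses at `0`. -/
theorem lintegral_mul_gaussianPDF_one (v : ℝ≥0) (F : ℝ → ℝ≥0∞) :
    ∫⁻ x, F x * gaussianPDF 0 1 x ∂(gaussianReal 0 v) =
      ENNReal.ofReal (√(2 * Real.pi * (1 + v)))⁻¹ * ∫⁻ x, F x ∂(gaussianReal 0 (v / (1 + v))) := by
  rcases eq_or_ne v 0 with rfl | hv
  · simp [gaussianPDF, gaussianPDFReal, mul_comm]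
  · have hv2 : v / (1 + v) ≠ 0 := by positivity
    rw [gaussianReal_of_var_ne_zero _ hv, gaussianReal_of_var_ne_zero _ hv2,
      lintegral_withDensity_eq_lintegral_mul_non_measurable _ (measurable_gaussianPDF _ _)
        (ae_of_all _ fun x => gaussianPDF_lt_top),
      lintegral_withDensity_eq_lintegral_mul_non_measurable _ (measurable_gaussianPDF _ _)
        (ae_of_all _ fun x => gaussianPDF_lt_top), ← lintegral_const_mul' _ _ ENNReal.ofReal_ne_top]
    refine lintegral_congr fun x => ?_
    simp only [Pi.mul_apply, gaussianPDF]
    rw [← mul_assoc (ENNReal.ofReal (√(2 * Real.pi * (1 + (v : ℝ))))⁻¹),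
      ← ENNReal.ofReal_mul (inv_nonneg.2 (Real.sqrt_nonneg _)),
      ← gaussianPDFReal_mul_gaussianPDFReal_one hv,
      ENNReal.ofReal_mul (gaussianPDFReal_nonneg _ _ _)]
    ring

section StandardGaussian

variable {ι : Type*} [Fintype ι]

theorem covariance_sum_mul_pi_gaussianReal (u v : ι → ℝ) :
    cov[fun η : ι → ℝ => ∑ i, η i * u i, fun η => ∑ i, η i * v i;
      Measure.pi fun _ : ι => gaussianReal 0 1] = ∑ i, u i * v i := by
  classical
  have hL2 : ∀ i, MemLp (fun η : ι → ℝ => η i) 2 (Measure.pi fun _ : ι => gaussianReal 0 1) :=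
    fun i => (IsGaussian.memLp_two_id (μ := gaussianReal 0 1)).comp_measurePreserving
      (measurePreserving_eval _ i)
  rw [covariance_fun_sum_fun_sum (fun i => (hL2 i).mul_const _) (fun i => (hL2 i).mul_const _)]
  have hc : ∀ i j, cov[fun η : ι → ℝ => η i, fun η => η j;
      Measure.pi fun _ : ι => gaussianReal 0 1] = if i = j then 1 else 0 := by
    intro i j
    split_ifs with hij
    · subst hij
      rw [covariance_self (measurable_pi_apply i).aemeasurable]
      have := variance_map (X := fun x : ℝ => x) (μ := Measure.pi fun _ : ι => gaussianReal 0 1)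
        (Y := fun η : ι → ℝ => η i) (by fun_prop) (measurable_pi_apply i).aemeasurable
      rw [(measurePreserving_eval _ i).map_eq] at this
      simpa [Function.comp_def] using this.symm
    · exact ((iIndepFun_pi (μ := fun _ : ι => gaussianReal 0 1) (X := fun _ x => x)
        (fun _ => by fun_prop)).indepFun hij).covariance_eq_zero (hL2 i) (hL2 j)
  simp_rw [covariance_mul_const_left, covariance_mul_const_right, hc]
  simp [Finset.sum_ite_eq, mul_comm]

instance isGaussian_pi_gaussianReal : IsGaussian (Measure.pi fun _ : ι => gaussianReal 0 1) := by
  have h := iIndepFun.hasGaussianLaw (P := Measure.pi fun _ : ι => gaussianReal 0 1)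
    (X := fun i (η : ι → ℝ) => η i)
    (fun i => ⟨by rw [(measurePreserving_eval _ i).map_eq]; infer_instance⟩)
    (iIndepFun_pi (X := fun _ x => x) (fun _ => by fun_prop))
  simpa using h.isGaussian_map

theorem hasGaussianLaw_sum_mul_pi (u : ι → ℝ) :
    HasGaussianLaw (fun η : ι → ℝ => ∑ i, η i * u i)
      (Measure.pi fun _ : ι => gaussianReal 0 1) := by
  have h := (IsGaussian.hasGaussianLaw_id (μ := Measure.pi fun _ : ι => gaussianReal 0 1)).map_fun
    (∑ i, (u i) • ContinuousLinearMap.proj (R := ℝ) (φ := fun _ : ι => ℝ) i)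
  convert! h using 2 with η
  simp [mul_comm]

theorem hasGaussianLaw_prodMk_sum_mul_pi (u v : ι → ℝ) :
    HasGaussianLaw (fun η : ι → ℝ => (∑ i, η i * u i, ∑ i, η i * v i))
      (Measure.pi fun _ : ι => gaussianReal 0 1) := by
  have h := (IsGaussian.hasGaussianLaw_id (μ := Measure.pi fun _ : ι => gaussianReal 0 1)).map_fun
    ((∑ i, (u i) • ContinuousLinearMap.proj (R := ℝ) (φ := fun _ : ι => ℝ) i).prod
      (∑ i, (v i) • ContinuousLinearMap.proj (R := ℝ) (φ := fun _ : ι => ℝ) i))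
  convert! h using 2 with η
  simp [mul_comm]

theorem map_sum_mul_pi_gaussianReal (u : ι → ℝ) :
    (Measure.pi fun _ : ι => gaussianReal 0 1).map (fun η : ι → ℝ => ∑ i, η i * u i) =
      gaussianReal 0 (∑ i, u i ^ 2).toNNReal := by
  have hint : ∀ i, Integrable (fun η : ι → ℝ => η i) (Measure.pi fun _ : ι => gaussianReal 0 1) :=
    fun i => (measurePreserving_eval (fun _ : ι => gaussianReal 0 1) i).integrable_comp_of_integrable
      (g := fun x => x) (IsGaussian.integrable_fun_id (μ := gaussianReal 0 1))
  rw [(hasGaussianLaw_sum_mul_pi u).map_eq_gaussianReal,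
    ← covariance_self (hasGaussianLaw_sum_mul_pi u).aemeasurable,
    covariance_sum_mul_pi_gaussianReal]
  congr 1
  · rw [integral_finsetSum _ fun i _ => (hint i).mul_const _]
    refine Finset.sum_eq_zero fun i _ => ?_
    rw [integral_mul_const]
    have := integral_map (μ := Measure.pi fun _ : ι => gaussianReal 0 1)
      (φ := fun η : ι → ℝ => η i) (f := fun x : ℝ => x) (measurable_pi_apply i).aemeasurable
      (by fun_prop)
    rw [(measurePreserving_eval _ i).map_eq] at this
    rw [← this]
    simp
  · simp [sq]

/-- Write `v = b u + m` with `m` orthogonal to `u`. The variables `⟨η, u⟩` and `⟨η, m⟩` are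
independent, and the density factor only shrinks the variance of the first from `U` to `U / (1 +
U)`. What remains is the mean absolute value of a centered Gaussian. -/
theorem lintegral_abs_mul_gaussianPDF_pi (u v : ι → ℝ) :
    ∫⁻ η : ι → ℝ, ENNReal.ofReal |∑ i, η i * v i| * gaussianPDF 0 1 (∑ i, η i * u i)
        ∂(Measure.pi fun _ : ι => gaussianReal 0 1) =
      ENNReal.ofReal (1 / Real.pi * (√((1 + ∑ i, u i ^ 2) * (∑ i, v i ^ 2) -
        (∑ i, u i * v i) ^ 2) / (1 + ∑ i, u i ^ 2))) := by
  set μ := Measure.pi fun _ : ι => gaussianReal 0 1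
  set U : ℝ := ∑ i, u i ^ 2 with hU
  set V : ℝ := ∑ i, v i ^ 2 with hV
  set W : ℝ := ∑ i, u i * v i with hW
  have hU0 : 0 ≤ U := Finset.sum_nonneg fun i _ => sq_nonneg _
  -- If `U = 0` then `b = 0` by convention; `W = b U` survives because then `u = 0`.
  set b : ℝ := W / U with hb
  have hWb : W = b * U := by
    rcases eq_or_ne U 0 with h0 | h0
    · have hu : ∀ i, u i = 0 := by
        intro i
        have := (Finset.sum_eq_zero_iff_of_nonneg (fun i _ => sq_nonneg (u i))).1 h0 i
          (Finset.mem_univ i)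
        simpa using this
      rw [h0, mul_zero, hW]
      simp [hu]
    · rw [hb]; field_simp
  let m : ι → ℝ := fun i => v i - b * u i
  have hM : ∑ i, m i ^ 2 = V - b ^ 2 * U := by
    have : ∀ i, m i ^ 2 = v i ^ 2 - 2 * b * (u i * v i) + b ^ 2 * u i ^ 2 := fun i => by
      simp only [m]; ring
    simp_rw [this, Finset.sum_add_distrib, Finset.sum_sub_distrib, ← Finset.mul_sum]
    rw [← hV, ← hW, ← hU, hWb]; ring
  have hum : ∑ i, u i * m i = 0 := by
    have : ∀ i, u i * m i = u i * v i - b * u i ^ 2 := fun i => by simp only [m]; ring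
    simp_rw [this, Finset.sum_sub_distrib, ← Finset.mul_sum]
    rw [← hW, ← hU, hWb]; ring
  have hM0 : 0 ≤ V - b ^ 2 * U := hM ▸ Finset.sum_nonneg fun i _ => sq_nonneg _
  have hindep : IndepFun (fun η : ι → ℝ => ∑ i, η i * u i) (fun η => ∑ i, η i * m i) μ :=
    (hasGaussianLaw_prodMk_sum_mul_pi u m).indepFun_of_covariance_eq_zero
      (by rw [covariance_sum_mul_pi_gaussianReal, hum])
  have hmap : μ.map (fun η : ι → ℝ => (∑ i, η i * u i, ∑ i, η i * m i)) =
      (gaussianReal 0 U.toNNReal).prod (gaussianReal 0 (V - b ^ 2 * U).toNNReal) := by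
    rw [(indepFun_iff_map_prod_eq_prod_map_map
      (hasGaussianLaw_sum_mul_pi u).aemeasurable (hasGaussianLaw_sum_mul_pi m).aemeasurable).1 hindep,
      map_sum_mul_pi_gaussianReal, map_sum_mul_pi_gaussianReal, hM]
  have hsum : ∀ η : ι → ℝ, ∑ i, η i * v i = b * (∑ i, η i * u i) + ∑ i, η i * m i := by
    intro η
    rw [Finset.mul_sum, ← Finset.sum_add_distrib]
    exact Finset.sum_congr rfl fun i _ => by simp only [m]; ring
  simp_rw [hsum]
  have hmeas : Measurable fun p : ℝ × ℝ => ENNReal.ofReal |b * p.1 + p.2| * gaussianPDF 0 1 p.1 :=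
    (by fun_prop)
  rw [← lintegral_map (μ := μ) (g := fun η : ι → ℝ => (∑ i, η i * u i, ∑ i, η i * m i)) hmeas
    (by fun_prop), hmap, lintegral_prod_symm' _ hmeas]
  simp_rw [lintegral_mul_gaussianPDF_one U.toNNReal]
  rw [lintegral_const_mul' _ _ ENNReal.ofReal_ne_top]
  have hconv : ∫⁻ y, ∫⁻ x, ENNReal.ofReal |b * x + y|
        ∂(gaussianReal 0 (U.toNNReal / (1 + U.toNNReal)))
        ∂(gaussianReal 0 (V - b ^ 2 * U).toNNReal) =
      ∫⁻ z, ENNReal.ofReal |z| ∂(gaussianReal 0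
        (.mk (b ^ 2) (sq_nonneg b) * (U.toNNReal / (1 + U.toNNReal)) +
          (V - b ^ 2 * U).toNNReal)) := by
    have h := gaussianReal_conv_gaussianReal (m₁ := 0) (m₂ := 0)
      (v₁ := .mk (b ^ 2) (sq_nonneg b) * (U.toNNReal / (1 + U.toNNReal)))
      (v₂ := (V - b ^ 2 * U).toNNReal)
    rw [add_zero] at h
    rw [← h, Measure.conv, lintegral_map (by fun_prop) (by fun_prop),
      lintegral_prod_symm' _ (by fun_prop)]
    refine lintegral_congr fun y => ?_
    have h2 := gaussianReal_map_const_mul (μ := 0) (v := U.toNNReal / (1 + U.toNNReal)) b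
    rw [mul_zero] at h2
    rw [← h2, lintegral_map (by fun_prop) (by fun_prop)]
  rw [hconv, lintegral_abs_gaussianReal, ← ENNReal.ofReal_mul (by positivity)]
  congr 1
  push_cast
  rw [Real.coe_toNNReal _ hU0, Real.coe_toNNReal _ hM0]
  have h1U : 0 < 1 + U := by linarith
  have hpi := Real.pi_pos
  change (√(2 * Real.pi * (1 + U)))⁻¹ * √(2 * (b ^ 2 * (U / (1 + U)) + (V - b ^ 2 * U)) / Real.pi) = _
  rw [← Real.sqrt_inv, ← Real.sqrt_mul (by positivity)]
  have e : (2 * Real.pi * (1 + U))⁻¹ * (2 * (b ^ 2 * (U / (1 + U)) + (V - b ^ 2 * U)) / Real.pi) =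
      ((1 + U) * V - W ^ 2) / (Real.pi * (1 + U)) ^ 2 := by
    rw [hWb]; field_simp; ring
  rw [e, Real.sqrt_div' _ (by positivity), Real.sqrt_sq (by positivity)]
  field_simp

end StandardGaussian

/-! ### The Kac-Rice formula -/

/-- The Kac-Rice formula of Edelman and Kostlan for a random linear combination of functions
with independent standard Gaussian coefficients. -/
theorem lintegral_encard_zeros_gaussian {d : ℕ} {E : Set ℝ} (hE : MeasurableSet E)
    {c c' : ℝ → Fin (d + 1) → ℝ}
    (hc : ∀ t i, HasStrictDerivAt (fun s => c s i) (c' t i) t) (h0 : ∀ t ∈ E, c t 0 ≠ 0) :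
    ∫⁻ η : Fin d → ℝ, ∫⁻ x, (({t : ℝ | t ∈ E ∧ x * c t 0 + ∑ i, η i * c t (Fin.succ i) = 0}.encard :
        ℕ∞) : ℝ≥0∞) ∂(gaussianReal 0 1) ∂(Measure.pi fun _ => gaussianReal 0 1) =
      ∫⁻ t in E, ENNReal.ofReal (1 / Real.pi * (√((∑ i, c t i ^ 2) * (∑ i, c' t i ^ 2) -
        (∑ i, c t i * c' t i) ^ 2) / (∑ i, c t i ^ 2))) := by
  -- Dividing by `c t 0`, the time `t` is a zero exactly when `x = ∑ i, η i * u t i`. For fixed `η`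
  -- the zeros form a fibre over the level `x`, and the area formula integrates their number against
  -- the density of `x`. Here `v` is the derivative of `u`.
  let u : ℝ → Fin d → ℝ := fun t i => -(c t i.succ / c t 0)
  let v : ℝ → Fin d → ℝ := fun t i => -((c' t i.succ * c t 0 - c t i.succ * c' t 0) / c t 0 ^ 2)
  have hcm : ∀ i, Measurable fun t => c t i := fun i =>
    (continuous_iff_continuousAt.2 fun t => (hc t i).hasDerivAt.continuousAt).measurable
  have hcm' : ∀ i, Measurable fun t => c' t i := fun i => by
    have : (fun t => c' t i) = deriv fun s => c s i :=
      funext fun t => ((hc t i).hasDerivAt.deriv).symm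
    rw [this]; exact measurable_deriv _
  have hum : ∀ i, Measurable fun t => u t i := fun i => ((hcm _).div (hcm _)).neg
  have hvm : ∀ i, Measurable fun t => v t i := fun i =>
    ((((hcm' _).mul (hcm _)).sub ((hcm _).mul (hcm' _))).div ((hcm _).pow_const 2)).neg
  have hinner : ∀ η : Fin d → ℝ, ∫⁻ x, (({t : ℝ | t ∈ E ∧ x * c t 0 +
        ∑ i, η i * c t (Fin.succ i) = 0}.encard : ℕ∞) : ℝ≥0∞) ∂(gaussianReal 0 1) =
      ∫⁻ t in E, ENNReal.ofReal |∑ i, η i * v t i| * gaussianPDF 0 1 (∑ i, η i * u t i) := by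
    intro η
    rw [gaussianReal_of_var_ne_zero _ one_ne_zero,
      lintegral_withDensity_eq_lintegral_mul_non_measurable _ (measurable_gaussianPDF _ _)
        (ae_of_all _ fun x => gaussianPDF_lt_top)]
    rw [← lintegral_encard_fiber_mul hE (h := fun t => ∑ i, η i * u t i)
      (h' := fun t => ∑ i, η i * v t i) ?_ (measurable_gaussianPDF 0 1)]
    · refine lintegral_congr fun x => ?_
      rw [Pi.mul_apply, mul_comm]
      congr 4
      ext t
      refine and_congr_right fun ht => ?_
      have h0t := h0 t ht
      have : ∑ i, η i * u t i = -((∑ i, η i * c t (Fin.succ i)) / c t 0) := by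
        rw [Finset.sum_div, ← Finset.sum_neg_distrib]
        exact Finset.sum_congr rfl fun i _ => by simp only [u]; ring
      rw [this, neg_eq_iff_eq_neg, div_eq_iff h0t]
      constructor <;> intro h <;> linarith
    · intro t ht
      refine HasStrictDerivAt.fun_sum fun i _ => HasStrictDerivAt.const_mul _ ?_
      exact ((hc t i.succ).fun_div (hc t 0) (h0 t ht)).fun_neg
  simp_rw [hinner]
  rw [lintegral_lintegral_swap (by
    refine Measurable.aemeasurable ?_
    refine Measurable.mul (Measurable.ennreal_ofReal (Measurable.abs ?_))
      ((measurable_gaussianPDF 0 1).comp ?_)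
    · exact Finset.measurable_sum _ fun i _ =>
        ((measurable_pi_apply i).comp measurable_fst).mul ((hvm i).comp measurable_snd)
    · exact Finset.measurable_sum _ fun i _ =>
        ((measurable_pi_apply i).comp measurable_fst).mul ((hum i).comp measurable_snd))]
  refine setLIntegral_congr_fun hE fun t ht => ?_
  rw [lintegral_abs_mul_gaussianPDF_pi]
  congr 2
  have h0t := h0 t ht
  set p := c t 0 with hp
  set p' := c' t 0 with hp'
  set A := ∑ i : Fin d, c t i.succ ^ 2 with hA
  set B := ∑ i : Fin d, c' t i.succ ^ 2 with hB
  set D := ∑ i : Fin d, c t i.succ * c' t i.succ with hD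
  have e1 : ∑ i, u t i ^ 2 = A / p ^ 2 := by
    rw [hA, Finset.sum_div]
    exact Finset.sum_congr rfl fun i _ => by simp only [u, ← hp]; ring
  have e2 : ∑ i, v t i ^ 2 = (p ^ 2 * B - 2 * p * p' * D + p' ^ 2 * A) / p ^ 4 := by
    rw [hA, hB, hD, Finset.mul_sum, Finset.mul_sum, Finset.mul_sum, ← Finset.sum_sub_distrib,
      ← Finset.sum_add_distrib, Finset.sum_div]
    exact Finset.sum_congr rfl fun i _ => by simp only [v, ← hp, ← hp']; ring
  have e3 : ∑ i, u t i * v t i = (p * D - p' * A) / p ^ 3 := by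
    rw [hA, hD, Finset.mul_sum, Finset.mul_sum, ← Finset.sum_sub_distrib, Finset.sum_div]
    exact Finset.sum_congr rfl fun i _ => by
      simp only [u, v, ← hp, ← hp']; field_simp
  have hA0 : 0 ≤ A := Finset.sum_nonneg fun i _ => sq_nonneg _
  have hp2 : 0 < p ^ 2 := by positivity
  rw [Fin.sum_univ_succ, Fin.sum_univ_succ, Fin.sum_univ_succ, ← hp, ← hp', ← hA, ← hB, ← hD,
    e1, e2, e3]
  -- Up to a power of `p`, the Gram determinant is invariant under the projective normalisation by
  -- `p`.
  have e4 : (1 + A / p ^ 2) * ((p ^ 2 * B - 2 * p * p' * D + p' ^ 2 * A) / p ^ 4) -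
      ((p * D - p' * A) / p ^ 3) ^ 2 =
      ((p ^ 2 + A) * (p' ^ 2 + B) - (p * p' + D) ^ 2) / (p ^ 2) ^ 2 := by
    field_simp; ring
  rw [e4, Real.sqrt_div' _ (by positivity), Real.sqrt_sq hp2.le]
  field_simp

/-! ### Two-dimensional representation of the coefficient processes -/

namespace IsCosineGaussian

variable {Ω : Type*} [MeasurableSpace Ω] {P : Measure Ω} {α : ℝ} {a b : ℕ → Ω → ℝ}

theorem hasGaussianLaw (ha : IsCosineGaussian P α a) {k : ℕ} (hk : 1 ≤ k) :
    HasGaussianLaw (a k) P := by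
  obtain ⟨j, rfl⟩ := Nat.exists_eq_add_of_le' hk
  exact ha.gaussian.hasGaussianLaw_eval j

theorem memLp_two (ha : IsCosineGaussian P α a) {k : ℕ} (hk : 1 ≤ k) : MemLp (a k) 2 P :=
  (ha.hasGaussianLaw hk).memLp_two

/-- The second moments are the inner products of the plane vectors `(cos kα, sin kα)`. Hence every
linear relation between these vectors holds almost surely between the variables. -/
theorem integral_linearCombination_mul (ha : IsCosineGaussian P α a) {ι κ : Type*} [Fintype ι]
    [Fintype κ] {f : ι → ℕ} {g : κ → ℕ} (hf : ∀ i, 1 ≤ f i) (hg : ∀ j, 1 ≤ g j)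
    (w : ι → ℝ) (v : κ → ℝ) :
    ∫ ω, (∑ i, w i * a (f i) ω) * (∑ j, v j * a (g j) ω) ∂P =
      (∑ i, w i * Real.cos (f i * α)) * (∑ j, v j * Real.cos (g j * α)) +
      (∑ i, w i * Real.sin (f i * α)) * (∑ j, v j * Real.sin (g j * α)) := by
  have hint : ∀ i j, Integrable (fun ω => (w i * a (f i) ω) * (v j * a (g j) ω)) P :=
    fun i j => MemLp.integrable_mul ((ha.memLp_two (hf i)).const_mul _)
      ((ha.memLp_two (hg j)).const_mul _)
  simp_rw [Finset.sum_mul_sum]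
  rw [integral_finsetSum _ fun i _ => integrable_finsetSum _ fun j _ => hint i j,
    ← Finset.sum_add_distrib]
  refine Finset.sum_congr rfl fun i _ => ?_
  rw [integral_finsetSum _ fun j _ => hint i j, ← Finset.sum_add_distrib]
  refine Finset.sum_congr rfl fun j _ => ?_
  have : ∀ ω, (w i * a (f i) ω) * (v j * a (g j) ω) = (w i * v j) * (a (f i) ω * a (g j) ω) :=
    fun ω => by ring
  simp_rw [this]
  rw [integral_const_mul, ha.correlation _ _ (hf i) (hg j), sub_mul, Real.cos_sub]
  ring

/-- The coefficient of `cos (k α)` in the representation of a cosine Gaussian process. -/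
noncomputable def cosCoeff (_ : IsCosineGaussian P α a) (ω : Ω) : ℝ :=
  ∑ i : Fin 2, ![Real.sin (2 * α) / Real.sin α, -1] i * a (![1, 2] i) ω

/-- The coefficient of `sin (k α)` in the representation of a cosine Gaussian process. -/
noncomputable def sinCoeff (_ : IsCosineGaussian P α a) (ω : Ω) : ℝ :=
  ∑ i : Fin 2, ![-(Real.cos (2 * α) / Real.sin α), Real.cos α / Real.sin α] i * a (![1, 2] i) ω

theorem one_le_vec (i : Fin 2) : 1 ≤ (![1, 2] : Fin 2 → ℕ) i := by
  fin_cases i <;> simp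

theorem ae_eq (ha : IsCosineGaussian P α a) (hα : Real.sin α ≠ 0) {k : ℕ} (hk : 1 ≤ k) :
    ∀ᵐ ω ∂P, a k ω = ha.cosCoeff ω * Real.cos (k * α) + ha.sinCoeff ω * Real.sin (k * α) := by
  let f : Fin 3 → ℕ := ![k, 1, 2]
  have hf : ∀ i, 1 ≤ f i := by
    intro i; fin_cases i <;> simp [f, hk]
  -- Cramer's rule: the vector of index `k` is a combination of those of indices `1` and `2`, whose
  -- determinant is `sin α`. The corresponding combination of variables has zero second moment.
  let w : Fin 3 → ℝ := ![1,
    -(Real.sin (2 * α) / Real.sin α * Real.cos (k * α) -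
      Real.cos (2 * α) / Real.sin α * Real.sin (k * α)),
    -(-1 * Real.cos (k * α) + Real.cos α / Real.sin α * Real.sin (k * α))]
  have hI := ha.integral_linearCombination_mul hf hf w w
  have hc : ∑ i, w i * Real.cos (f i * α) = 0 := by
    simp only [Fin.sum_univ_three, w, f, Matrix.cons_val_zero, Matrix.cons_val_one,
      Matrix.cons_val]
    push_cast
    rw [Real.sin_two_mul, Real.cos_two_mul', one_mul, one_mul]
    field_simp
    linear_combination -(Real.cos (k * α) * Real.sin α) * Real.sin_sq_add_cos_sq α
  have hs : ∑ i, w i * Real.sin (f i * α) = 0 := by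
    simp only [Fin.sum_univ_three, w, f, Matrix.cons_val_zero, Matrix.cons_val_one,
      Matrix.cons_val]
    push_cast
    rw [Real.sin_two_mul, Real.cos_two_mul', one_mul, one_mul]
    field_simp
    linear_combination -Real.sin (k * α) * Real.sin_sq_add_cos_sq α
  rw [hc, hs, mul_zero, add_zero] at hI
  have hmem : MemLp (fun ω => ∑ i, w i * a (f i) ω) 2 P :=
    memLp_finsetSum _ fun i _ => (ha.memLp_two (hf i)).const_mul _
  have h0 := (integral_eq_zero_iff_of_nonneg (fun ω => mul_self_nonneg _)
    (hmem.integrable_mul hmem)).1 hI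
  filter_upwards [h0] with ω hω
  have hω' : ∑ i, w i * a (f i) ω = 0 := mul_self_eq_zero.1 hω
  simp only [Fin.sum_univ_three, w, f, Matrix.cons_val_zero, Matrix.cons_val_one,
      Matrix.cons_val] at hω'
  simp only [cosCoeff, sinCoeff, Fin.sum_univ_two, Matrix.cons_val_zero, Matrix.cons_val_one]
  linarith

theorem integral_linearCombination (ha : IsCosineGaussian P α a) {ι : Type*} [Fintype ι]
    {f : ι → ℕ} (hf : ∀ i, 1 ≤ f i) (w : ι → ℝ) : ∫ ω, ∑ i, w i * a (f i) ω ∂P = 0 := by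
  rw [integral_finsetSum _ fun i _ => ((ha.hasGaussianLaw (hf i)).integrable).const_mul _]
  exact Finset.sum_eq_zero fun i _ => by rw [integral_const_mul, ha.centered _ (hf i), mul_zero]

theorem covariance_linearCombination [IsProbabilityMeasure P] (ha : IsCosineGaussian P α a)
    {ι κ : Type*} [Fintype ι] [Fintype κ] {f : ι → ℕ} {g : κ → ℕ} (hf : ∀ i, 1 ≤ f i)
    (hg : ∀ j, 1 ≤ g j) (w : ι → ℝ) (v : κ → ℝ) :
    cov[fun ω => ∑ i, w i * a (f i) ω, fun ω => ∑ j, v j * a (g j) ω; P] =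
      (∑ i, w i * Real.cos (f i * α)) * (∑ j, v j * Real.cos (g j * α)) +
      (∑ i, w i * Real.sin (f i * α)) * (∑ j, v j * Real.sin (g j * α)) := by
  rw [covariance_eq_sub (memLp_finsetSum _ fun i _ => (ha.memLp_two (hf i)).const_mul _)
    (memLp_finsetSum _ fun i _ => (ha.memLp_two (hg i)).const_mul _),
    ha.integral_linearCombination hf, zero_mul, sub_zero]
  exact ha.integral_linearCombination_mul hf hg w v

/-- The two rows of weights are dual to the coordinates of the vectors `(cos kα, sin kα)`, `k = 1,
2`, so they select the standard basis of the plane. -/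
theorem covariance_coeff [IsProbabilityMeasure P] (ha : IsCosineGaussian P α a)
    (hα : Real.sin α ≠ 0) :
    cov[ha.cosCoeff, ha.cosCoeff; P] = 1 ∧ cov[ha.cosCoeff, ha.sinCoeff; P] = 0 ∧
      cov[ha.sinCoeff, ha.sinCoeff; P] = 1 := by
  have h1 : ∑ i : Fin 2, ![Real.sin (2 * α) / Real.sin α, -1] i *
      Real.cos ((![1, 2] : Fin 2 → ℕ) i * α) = 1 := by
    simp only [Fin.sum_univ_two, Matrix.cons_val_zero, Matrix.cons_val_one]
    push_cast
    rw [Real.sin_two_mul, Real.cos_two_mul, one_mul]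
    field_simp; ring
  have h2 : ∑ i : Fin 2, ![Real.sin (2 * α) / Real.sin α, -1] i *
      Real.sin ((![1, 2] : Fin 2 → ℕ) i * α) = 0 := by
    simp only [Fin.sum_univ_two, Matrix.cons_val_zero, Matrix.cons_val_one]
    push_cast
    rw [one_mul]
    field_simp; ring
  have h3 : ∑ i : Fin 2, ![-(Real.cos (2 * α) / Real.sin α), Real.cos α / Real.sin α] i *
      Real.cos ((![1, 2] : Fin 2 → ℕ) i * α) = 0 := by
    simp only [Fin.sum_univ_two, Matrix.cons_val_zero, Matrix.cons_val_one]
    push_cast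
    rw [one_mul]
    field_simp; ring
  have h4 : ∑ i : Fin 2, ![-(Real.cos (2 * α) / Real.sin α), Real.cos α / Real.sin α] i *
      Real.sin ((![1, 2] : Fin 2 → ℕ) i * α) = 1 := by
    simp only [Fin.sum_univ_two, Matrix.cons_val_zero, Matrix.cons_val_one]
    push_cast
    rw [Real.sin_two_mul, Real.cos_two_mul, one_mul]
    field_simp; ring
  refine ⟨?_, ?_, ?_⟩
  · refine (ha.covariance_linearCombination one_le_vec one_le_vec _ _).trans ?_
    rw [h1, h2]; norm_num
  · refine (ha.covariance_linearCombination one_le_vec one_le_vec _ _).trans ?_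
    rw [h1, h2, h3, h4]; norm_num
  · refine (ha.covariance_linearCombination one_le_vec one_le_vec _ _).trans ?_
    rw [h3, h4]; norm_num

/-- The random vector of coefficients of a pair of cosine Gaussian processes. -/
noncomputable def coeffVec (ha : IsCosineGaussian P α a) (hb : IsCosineGaussian P α b) :
    Fin 4 → Ω → ℝ :=
  ![ha.cosCoeff, ha.sinCoeff, hb.cosCoeff, hb.sinCoeff]

theorem coeffVec_apply (ha : IsCosineGaussian P α a) (hb : IsCosineGaussian P α b) (ω : Ω) :
    (fun i => ha.coeffVec hb i ω) =
      ![ha.cosCoeff ω, ha.sinCoeff ω, hb.cosCoeff ω, hb.sinCoeff ω] := by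
  funext i; fin_cases i <;> rfl

theorem hasGaussianLaw_coeffVec (ha : IsCosineGaussian P α a) (hb : IsCosineGaussian P α b)
    (hab : IndepFun (fun ω (k : ℕ) => a (k + 1) ω) (fun ω (k : ℕ) => b (k + 1) ω) P) :
    HasGaussianLaw (fun ω i => ha.coeffVec hb i ω) P := by
  have hab' : IndepFun (fun ω => (a 1 ω, a 2 ω)) (fun ω => (b 1 ω, b 2 ω)) P :=
    hab.comp (φ := fun f : ℕ → ℝ => (f 0, f 1)) (ψ := fun f : ℕ → ℝ => (f 0, f 1))
      ((measurable_pi_apply 0).prodMk (measurable_pi_apply 1))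
      ((measurable_pi_apply 0).prodMk (measurable_pi_apply 1))
  have hG := IndepFun.hasGaussianLaw (ha.gaussian.hasGaussianLaw_prodMk (s := 0) (t := 1))
    (hb.gaussian.hasGaussianLaw_prodMk (s := 0) (t := 1)) hab'
  let f1 : (ℝ × ℝ) × (ℝ × ℝ) →L[ℝ] ℝ :=
    (ContinuousLinearMap.fst ℝ ℝ ℝ).comp (ContinuousLinearMap.fst ℝ (ℝ × ℝ) (ℝ × ℝ))
  let f2 : (ℝ × ℝ) × (ℝ × ℝ) →L[ℝ] ℝ :=
    (ContinuousLinearMap.snd ℝ ℝ ℝ).comp (ContinuousLinearMap.fst ℝ (ℝ × ℝ) (ℝ × ℝ))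
  let f3 : (ℝ × ℝ) × (ℝ × ℝ) →L[ℝ] ℝ :=
    (ContinuousLinearMap.fst ℝ ℝ ℝ).comp (ContinuousLinearMap.snd ℝ (ℝ × ℝ) (ℝ × ℝ))
  let f4 : (ℝ × ℝ) × (ℝ × ℝ) →L[ℝ] ℝ :=
    (ContinuousLinearMap.snd ℝ ℝ ℝ).comp (ContinuousLinearMap.snd ℝ (ℝ × ℝ) (ℝ × ℝ))
  have h := hG.map_fun (ContinuousLinearMap.pi
    ![(Real.sin (2 * α) / Real.sin α) • f1 + (-1 : ℝ) • f2,
      (-(Real.cos (2 * α) / Real.sin α)) • f1 + (Real.cos α / Real.sin α) • f2,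
      (Real.sin (2 * α) / Real.sin α) • f3 + (-1 : ℝ) • f4,
      (-(Real.cos (2 * α) / Real.sin α)) • f3 + (Real.cos α / Real.sin α) • f4])
  convert! h using 1
  funext ω i
  fin_cases i <;>
    simp [coeffVec, cosCoeff, sinCoeff, f1, f2, f3, f4]

/-- The four coefficients are jointly Gaussian, centered and uncorrelated with unit variance, hence
independent standard Gaussians. -/
theorem map_coeffVec [IsProbabilityMeasure P] (ha : IsCosineGaussian P α a)
    (hb : IsCosineGaussian P α b) (hα : Real.sin α ≠ 0)
    (hab : IndepFun (fun ω (k : ℕ) => a (k + 1) ω) (fun ω (k : ℕ) => b (k + 1) ω) P) :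
    P.map (fun ω i => ha.coeffVec hb i ω) = Measure.pi fun _ : Fin 4 => gaussianReal 0 1 := by
  have hG := ha.hasGaussianLaw_coeffVec hb hab
  have hGi : ∀ i, HasGaussianLaw (ha.coeffVec hb i) P := fun i => hG.eval i
  obtain ⟨a1, a2, a3⟩ := ha.covariance_coeff hα
  obtain ⟨b1, b2, b3⟩ := hb.covariance_coeff hα
  have hcross : ∀ p q r s : ℝ,
      cov[fun ω => ∑ i, ![p, q] i * a (![1, 2] i) ω,
        fun ω => ∑ i, ![r, s] i * b (![1, 2] i) ω; P] = 0 := by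
    intro p q r s
    have hind := hab.comp (φ := fun f : ℕ → ℝ => p * f 0 + q * f 1)
      (ψ := fun f : ℕ → ℝ => r * f 0 + s * f 1)
      (by fun_prop) (by fun_prop)
    have h := hind.covariance_eq_zero
      (((ha.memLp_two le_rfl).const_mul p).add ((ha.memLp_two one_le_two).const_mul q))
      (((hb.memLp_two le_rfl).const_mul r).add ((hb.memLp_two one_le_two).const_mul s))
    simpa [Fin.sum_univ_two, Function.comp_def] using h
  have c1 : cov[ha.cosCoeff, hb.cosCoeff; P] = 0 := hcross _ _ _ _
  have c2 : cov[ha.cosCoeff, hb.sinCoeff; P] = 0 := hcross _ _ _ _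
  have c3 : cov[ha.sinCoeff, hb.cosCoeff; P] = 0 := hcross _ _ _ _
  have c4 : cov[ha.sinCoeff, hb.sinCoeff; P] = 0 := hcross _ _ _ _
  have hind : iIndepFun (ha.coeffVec hb) P := by
    refine hG.iIndepFun_of_covariance_eq_zero fun i j hij => ?_
    fin_cases i <;> fin_cases j <;> first
      | exact absurd rfl hij
      | assumption
      | (rw [covariance_comm]; assumption)
  rw [(iIndepFun_iff_map_fun_eq_pi_map fun i => (hGi i).aemeasurable).1 hind]
  congr 1
  funext i
  rw [(hGi i).map_eq_gaussianReal, ← covariance_self (hGi i).aemeasurable]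
  have hm : ∫ ω, ha.coeffVec hb i ω ∂P = 0 := by
    fin_cases i
    · exact ha.integral_linearCombination one_le_vec _
    · exact ha.integral_linearCombination one_le_vec _
    · exact hb.integral_linearCombination one_le_vec _
    · exact hb.integral_linearCombination one_le_vec _
  have hv : cov[ha.coeffVec hb i, ha.coeffVec hb i; P] = 1 := by
    fin_cases i <;> assumption
  rw [hm, hv, Real.toNNReal_one]

end IsCosineGaussian

/-! ### Reduction to four standard Gaussians -/

/-- The trigonometric polynomial whose coefficients are the cosine sequences of frequency `α` with
amplitudes `g`. -/
noncomputable def cosineTrigPoly (α : ℝ) (n : ℕ) (g : Fin 4 → ℝ) : ℝ → ℝ :=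
  trigPoly (fun k => g 0 * Real.cos (k * α) + g 1 * Real.sin (k * α))
    (fun k => g 2 * Real.cos (k * α) + g 3 * Real.sin (k * α)) n

theorem measurable_zeroCount_cosineTrigPoly (α : ℝ) (n : ℕ) :
    Measurable fun g => zeroCount (cosineTrigPoly α n g) := by
  refine measurable_zeroCount ?_
  unfold Function.uncurry cosineTrigPoly trigPoly
  fun_prop

section

variable {Ω : Type*} [MeasurableSpace Ω] {P : Measure Ω} {α : ℝ} {a b : ℕ → Ω → ℝ}

theorem randomZeroCount_ae_eq (ha : IsCosineGaussian P α a) (hb : IsCosineGaussian P α b)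
    (hα : Real.sin α ≠ 0) (n : ℕ) :
    ∀ᵐ ω ∂P, randomZeroCount a b n ω =
      zeroCount (cosineTrigPoly α n fun i => ha.coeffVec hb i ω) := by
  have h : ∀ᵐ ω ∂P, ∀ k : ℕ, 1 ≤ k →
      (a k ω = ha.cosCoeff ω * Real.cos (k * α) + ha.sinCoeff ω * Real.sin (k * α) ∧
       b k ω = hb.cosCoeff ω * Real.cos (k * α) + hb.sinCoeff ω * Real.sin (k * α)) := by
    rw [ae_all_iff]
    intro k
    by_cases hk : 1 ≤ k
    · filter_upwards [ha.ae_eq hα hk, hb.ae_eq hα hk] with ω h1 h2 _ using ⟨h1, h2⟩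
    · exact ae_of_all _ fun ω h => absurd h hk
  filter_upwards [h] with ω hω
  unfold randomZeroCount
  congr 1
  funext t
  rw [ha.coeffVec_apply hb, cosineTrigPoly, trigPoly, trigPoly]
  congr 1
  refine Finset.sum_congr rfl fun k hk => ?_
  obtain ⟨h1, h2⟩ := hω k (Finset.mem_Icc.1 hk).1
  rw [h1, h2]
  rfl

theorem aemeasurable_randomZeroCount (ha : IsCosineGaussian P α a) (hb : IsCosineGaussian P α b)
    (hα : Real.sin α ≠ 0)
    (hab : IndepFun (fun ω (k : ℕ) => a (k + 1) ω) (fun ω (k : ℕ) => b (k + 1) ω) P) (n : ℕ) :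
    AEMeasurable (randomZeroCount a b n) P :=
  ((measurable_zeroCount_cosineTrigPoly α n).comp_aemeasurable
    (ha.hasGaussianLaw_coeffVec hb hab).aemeasurable).congr
    ((randomZeroCount_ae_eq ha hb hα n).mono fun _ h => h.symm)

theorem expectedZeros_eq_lintegral_pi [IsProbabilityMeasure P] (ha : IsCosineGaussian P α a)
    (hb : IsCosineGaussian P α b) (hα : Real.sin α ≠ 0)
    (hab : IndepFun (fun ω (k : ℕ) => a (k + 1) ω) (fun ω (k : ℕ) => b (k + 1) ω) P) (n : ℕ) :
    expectedZeros P a b n = ∫⁻ g, zeroCount (cosineTrigPoly α n g)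
      ∂(Measure.pi fun _ : Fin 4 => gaussianReal 0 1) := by
  rw [expectedZeros, lintegral_congr_ae (randomZeroCount_ae_eq ha hb hα n),
    ← ha.map_coeffVec hb hα hab, lintegral_map' (measurable_zeroCount_cosineTrigPoly α n).aemeasurable
    (ha.hasGaussianLaw_coeffVec hb hab).aemeasurable]

/-- The variable `a 1` has variance one, so it is almost surely nonzero and the deterministic bound
applies. -/
theorem expectedZeros_ne_top [IsProbabilityMeasure P] (ha : IsCosineGaussian P α a) (b : ℕ → Ω → ℝ)
    {n : ℕ} (hn : 1 ≤ n) : expectedZeros P a b n ≠ ∞ := by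
  have h1 := ha.hasGaussianLaw le_rfl
  have hv : Var[a 1; P] = 1 := by
    rw [← covariance_self h1.aemeasurable, covariance_eq_sub h1.memLp_two h1.memLp_two,
      ha.centered 1 le_rfl, zero_mul, sub_zero]
    refine (ha.correlation 1 1 le_rfl le_rfl).trans ?_
    simp
  have hne : ∀ᵐ ω ∂P, a 1 ω ≠ 0 := by
    have hmap := h1.map_eq_gaussianReal
    rw [hv, Real.toNNReal_one] at hmap
    have := nullSingletonClass_gaussianReal (μ := P[a 1]) (v := 1) one_ne_zero
    have h0 : (P.map (a 1)) {0} = 0 := by rw [hmap]; exact measure_singleton 0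
    rw [Measure.map_apply_of_aemeasurable h1.aemeasurable (measurableSet_singleton 0)] at h0
    exact measure_eq_zero_iff_ae_notMem.1 h0
  have hle : expectedZeros P a b n ≤ ∫⁻ _, (2 * n + 1 : ℝ≥0∞) ∂P := by
    refine lintegral_mono_ae ?_
    filter_upwards [hne] with ω hω
    exact zeroCount_trigPoly_le _ _ n ⟨1, Finset.mem_Icc.2 ⟨le_rfl, hn⟩, Or.inl hω⟩
  refine ne_top_of_le_ne_top ?_ hle
  rw [lintegral_const, measure_univ, mul_one]
  exact ENNReal.add_ne_top.2 ⟨ENNReal.mul_ne_top (by simp) (by simp), by simp⟩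

end

/-! ### Closed form of the curve and its speed -/

theorem sin_mul_sum_cos (n : ℕ) (y : ℝ) :
    Real.sin y * ∑ k ∈ Finset.Icc 1 n, Real.cos (k * (2 * y)) =
      Real.sin (n * y) * Real.cos ((n + 1) * y) := by
  induction n with
  | zero => simp
  | succ n ih =>
    rw [Finset.sum_Icc_succ_top (by omega), mul_add, ih]
    push_cast
    rw [show ((n : ℝ) + 1) * (2 * y) = 2 * ((n + 1) * y) by ring,
      show (n : ℝ) * y = (n + 1) * y - y by ring,
      show ((n : ℝ) + 1 + 1) * y = (n + 1) * y + y by ring,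
      Real.cos_two_mul', Real.sin_sub, Real.cos_add]
    ring

theorem sin_mul_sum_sin (n : ℕ) (y : ℝ) :
    Real.sin y * ∑ k ∈ Finset.Icc 1 n, Real.sin (k * (2 * y)) =
      Real.sin (n * y) * Real.sin ((n + 1) * y) := by
  induction n with
  | zero => simp
  | succ n ih =>
    rw [Finset.sum_Icc_succ_top (by omega), mul_add, ih]
    push_cast
    rw [show ((n : ℝ) + 1) * (2 * y) = 2 * ((n + 1) * y) by ring,
      show (n : ℝ) * y = (n + 1) * y - y by ring,
      show ((n : ℝ) + 1 + 1) * y = (n + 1) * y + y by ring,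
      Real.sin_two_mul, Real.sin_sub, Real.sin_add]
    ring

theorem sum_cos_of_sin_eq_zero (n : ℕ) {y : ℝ} (hy : Real.sin y = 0) :
    ∑ k ∈ Finset.Icc 1 n, Real.cos (k * (2 * y)) = n := by
  obtain ⟨j, rfl⟩ := Real.sin_eq_zero_iff.1 hy
  have : ∀ k ∈ Finset.Icc 1 n, Real.cos ((k : ℝ) * (2 * ((j : ℝ) * Real.pi))) = 1 := by
    intro k _
    rw [show (k : ℝ) * (2 * ((j : ℝ) * Real.pi)) = ((k * j : ℤ) : ℝ) * (2 * Real.pi) by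
      push_cast; ring]
    exact Real.cos_int_mul_two_pi _
  rw [Finset.sum_congr rfl this]
  simp

/-- The four functions of which `√n * cosineTrigPoly α n g` is the linear combination with
coefficients `g`. -/
noncomputable def cosineBasis (α : ℝ) (n : ℕ) (t : ℝ) : Fin 4 → ℝ :=
  ![∑ k ∈ Finset.Icc 1 n, Real.cos (k * α) * Real.cos (k * t),
    ∑ k ∈ Finset.Icc 1 n, Real.sin (k * α) * Real.cos (k * t),
    ∑ k ∈ Finset.Icc 1 n, Real.cos (k * α) * Real.sin (k * t),
    ∑ k ∈ Finset.Icc 1 n, Real.sin (k * α) * Real.sin (k * t)]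

theorem cosineTrigPoly_eq (α : ℝ) (n : ℕ) (g : Fin 4 → ℝ) (t : ℝ) :
    cosineTrigPoly α n g t = 1 / √(n : ℝ) * ∑ i, g i * cosineBasis α n t i := by
  rw [cosineTrigPoly, trigPoly, Fin.sum_univ_four]
  congr 1
  simp only [cosineBasis, Matrix.cons_val_zero, Matrix.cons_val_one, Matrix.cons_val,
    Finset.mul_sum, ← Finset.sum_add_distrib]
  exact Finset.sum_congr rfl fun k _ => by ring

/-- The coordinate `sin (n (t - α) / 2) sin ((t + α) / 2)`. -/
noncomputable def ampMinus (α : ℝ) (n : ℕ) (t : ℝ) : ℝ :=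
  Real.sin (n * ((t - α) / 2)) * Real.sin ((t + α) / 2)

/-- The coordinate `sin (n (t + α) / 2) sin ((t - α) / 2)`. -/
noncomputable def ampPlus (α : ℝ) (n : ℕ) (t : ℝ) : ℝ :=
  Real.sin (n * ((t + α) / 2)) * Real.sin ((t - α) / 2)

/-- The derivative of `ampMinus`. -/
noncomputable def ampMinus' (α : ℝ) (n : ℕ) (t : ℝ) : ℝ :=
  n / 2 * Real.cos (n * ((t - α) / 2)) * Real.sin ((t + α) / 2) +
    1 / 2 * Real.sin (n * ((t - α) / 2)) * Real.cos ((t + α) / 2)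

/-- The derivative of `ampPlus`. -/
noncomputable def ampPlus' (α : ℝ) (n : ℕ) (t : ℝ) : ℝ :=
  n / 2 * Real.cos (n * ((t + α) / 2)) * Real.sin ((t - α) / 2) +
    1 / 2 * Real.sin (n * ((t + α) / 2)) * Real.cos ((t - α) / 2)

/-- The curve `2 sin ((t + α) / 2) sin ((t - α) / 2) cosineBasis α n t` in closed form. -/
noncomputable def cosineCurve (α : ℝ) (n : ℕ) (t : ℝ) : Fin 4 → ℝ :=
  ![ampMinus α n t * Real.cos ((n + 1) * ((t - α) / 2)) +
      ampPlus α n t * Real.cos ((n + 1) * ((t + α) / 2)),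
    -(ampMinus α n t * Real.sin ((n + 1) * ((t - α) / 2))) +
      ampPlus α n t * Real.sin ((n + 1) * ((t + α) / 2)),
    ampMinus α n t * Real.sin ((n + 1) * ((t - α) / 2)) +
      ampPlus α n t * Real.sin ((n + 1) * ((t + α) / 2)),
    ampMinus α n t * Real.cos ((n + 1) * ((t - α) / 2)) -
      ampPlus α n t * Real.cos ((n + 1) * ((t + α) / 2))]

/-- The derivative of `cosineCurve`. -/
noncomputable def cosineCurve' (α : ℝ) (n : ℕ) (t : ℝ) : Fin 4 → ℝ :=
  ![(ampMinus' α n t * Real.cos ((n + 1) * ((t - α) / 2)) -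
      (n + 1) / 2 * ampMinus α n t * Real.sin ((n + 1) * ((t - α) / 2))) +
      (ampPlus' α n t * Real.cos ((n + 1) * ((t + α) / 2)) -
      (n + 1) / 2 * ampPlus α n t * Real.sin ((n + 1) * ((t + α) / 2))),
    -(ampMinus' α n t * Real.sin ((n + 1) * ((t - α) / 2)) +
      (n + 1) / 2 * ampMinus α n t * Real.cos ((n + 1) * ((t - α) / 2))) +
      (ampPlus' α n t * Real.sin ((n + 1) * ((t + α) / 2)) +
      (n + 1) / 2 * ampPlus α n t * Real.cos ((n + 1) * ((t + α) / 2))),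
    (ampMinus' α n t * Real.sin ((n + 1) * ((t - α) / 2)) +
      (n + 1) / 2 * ampMinus α n t * Real.cos ((n + 1) * ((t - α) / 2))) +
      (ampPlus' α n t * Real.sin ((n + 1) * ((t + α) / 2)) +
      (n + 1) / 2 * ampPlus α n t * Real.cos ((n + 1) * ((t + α) / 2))),
    (ampMinus' α n t * Real.cos ((n + 1) * ((t - α) / 2)) -
      (n + 1) / 2 * ampMinus α n t * Real.sin ((n + 1) * ((t - α) / 2))) -
      (ampPlus' α n t * Real.cos ((n + 1) * ((t + α) / 2)) -
      (n + 1) / 2 * ampPlus α n t * Real.sin ((n + 1) * ((t + α) / 2)))]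

/-- Each product of trigonometric functions is half a sum or difference of terms at frequencies `t -
α` and `t + α`. The scalar factor supplies the denominators of the two Dirichlet kernels. -/
theorem two_mul_sin_mul_sin_mul_cosineBasis (α : ℝ) (n : ℕ) (t : ℝ) (i : Fin 4) :
    2 * (Real.sin ((t + α) / 2) * Real.sin ((t - α) / 2)) * cosineBasis α n t i =
      cosineCurve α n t i := by
  have h1 := sin_mul_sum_cos n ((t - α) / 2)
  have h2 := sin_mul_sum_cos n ((t + α) / 2)
  have h3 := sin_mul_sum_sin n ((t - α) / 2)
  have h4 := sin_mul_sum_sin n ((t + α) / 2)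
  have e1 : ∀ k : ℕ, (k : ℝ) * (2 * ((t - α) / 2)) = k * t - k * α := fun k => by ring
  have e2 : ∀ k : ℕ, (k : ℝ) * (2 * ((t + α) / 2)) = k * t + k * α := fun k => by ring
  simp only [e1, e2, Real.cos_sub, Real.cos_add, Real.sin_sub, Real.sin_add,
    Finset.sum_add_distrib, Finset.sum_sub_distrib] at h1 h2 h3 h4
  have c : ∀ f g : ℕ → ℝ, ∑ k ∈ Finset.Icc 1 n, f k * g k = ∑ k ∈ Finset.Icc 1 n, g k * f k :=
    fun f g => Finset.sum_congr rfl fun k _ => mul_comm _ _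
  have c1 := c (fun k => Real.cos (k * α)) (fun k => Real.cos (k * t))
  have c2 := c (fun k => Real.sin (k * α)) (fun k => Real.cos (k * t))
  have c3 := c (fun k => Real.cos (k * α)) (fun k => Real.sin (k * t))
  have c4 := c (fun k => Real.sin (k * α)) (fun k => Real.sin (k * t))
  fin_cases i <;> simp only [cosineBasis, cosineCurve, Matrix.cons_val_zero, Matrix.cons_val_one,
    Matrix.cons_val, Fin.zero_eta, Fin.mk_one, Fin.reduceFinMk, ampMinus, ampPlus]
  · rw [c1]
    linear_combination Real.sin ((t + α) / 2) * h1 + Real.sin ((t - α) / 2) * h2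
  · rw [c2]
    linear_combination -Real.sin ((t + α) / 2) * h3 + Real.sin ((t - α) / 2) * h4
  · rw [c3]
    linear_combination Real.sin ((t + α) / 2) * h3 + Real.sin ((t - α) / 2) * h4
  · rw [c4]
    linear_combination Real.sin ((t + α) / 2) * h1 - Real.sin ((t - α) / 2) * h2

theorem hasStrictDerivAt_cosineCurve (α : ℝ) (n : ℕ) (t : ℝ) (i : Fin 4) :
    HasStrictDerivAt (fun s => cosineCurve α n s i) (cosineCurve' α n t i) t := by
  have hm : HasStrictDerivAt (fun s : ℝ => (s - α) / 2) (1 / 2) t :=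
    HasStrictDerivAt.div_const ((hasStrictDerivAt_id t).sub_const α) 2
  have hp : HasStrictDerivAt (fun s : ℝ => (s + α) / 2) (1 / 2) t :=
    HasStrictDerivAt.div_const ((hasStrictDerivAt_id t).add_const α) 2
  have hM : HasStrictDerivAt (fun s => ampMinus α n s) (ampMinus' α n t) t := by
    convert! (hm.const_mul (n : ℝ)).sin.mul hp.sin using 1
    rw [ampMinus']; ring
  have hP : HasStrictDerivAt (fun s => ampPlus α n s) (ampPlus' α n t) t := by
    convert! (hp.const_mul (n : ℝ)).sin.mul hm.sin using 1
    rw [ampPlus']; ring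
  have h1 := hM.mul (hm.const_mul ((n : ℝ) + 1)).cos
  have h2 := hM.mul (hm.const_mul ((n : ℝ) + 1)).sin
  have h3 := hP.mul (hp.const_mul ((n : ℝ) + 1)).cos
  have h4 := hP.mul (hp.const_mul ((n : ℝ) + 1)).sin
  fin_cases i
  · convert! h1.add h3 using 1
    simp only [cosineCurve', Matrix.cons_val_zero, Fin.zero_eta]; ring
  · convert! h2.neg.add h4 using 1
    simp only [cosineCurve', Matrix.cons_val_one, Matrix.cons_val, Fin.mk_one]; ring
  · convert! h2.add h4 using 1
    simp only [cosineCurve', Matrix.cons_val, Fin.reduceFinMk]; ring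
  · convert! h1.sub h3 using 1
    simp only [cosineCurve', Matrix.cons_val, Fin.reduceFinMk]; ring

/-- The curve is `ampMinus • e₋ + ampPlus • e₊` with `e₋`, `e₊` orthogonal of squared norm `2`. -/
theorem sum_cosineCurve_sq (α : ℝ) (n : ℕ) (t : ℝ) :
    ∑ i, cosineCurve α n t i ^ 2 = 2 * (ampMinus α n t ^ 2 + ampPlus α n t ^ 2) := by
  have h1 := Real.sin_sq_add_cos_sq (((n : ℝ) + 1) * ((t - α) / 2))
  have h2 := Real.sin_sq_add_cos_sq (((n : ℝ) + 1) * ((t + α) / 2))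
  simp only [Fin.sum_univ_four, cosineCurve, Matrix.cons_val_zero, Matrix.cons_val_one,
    Matrix.cons_val]
  linear_combination 2 * ampMinus α n t ^ 2 * h1 + 2 * ampPlus α n t ^ 2 * h2

/-- The derivatives of `e₋` and `e₊` are orthogonal to each other and to both vectors, with norm `(n
+ 1)/2` times as large. Variation of the amplitudes and rotation therefore contribute separately. -/
theorem sum_cosineCurve'_sq (α : ℝ) (n : ℕ) (t : ℝ) :
    ∑ i, cosineCurve' α n t i ^ 2 = 2 * (ampMinus' α n t ^ 2 + ampPlus' α n t ^ 2 +
      ((n + 1) / 2) ^ 2 * (ampMinus α n t ^ 2 + ampPlus α n t ^ 2)) := by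
  have h1 := Real.sin_sq_add_cos_sq (((n : ℝ) + 1) * ((t - α) / 2))
  have h2 := Real.sin_sq_add_cos_sq (((n : ℝ) + 1) * ((t + α) / 2))
  simp only [Fin.sum_univ_four, cosineCurve', Matrix.cons_val_zero, Matrix.cons_val_one,
    Matrix.cons_val]
  linear_combination
    2 * (ampMinus' α n t ^ 2 + (((n : ℝ) + 1) / 2) ^ 2 * ampMinus α n t ^ 2) * h1 +
    2 * (ampPlus' α n t ^ 2 + (((n : ℝ) + 1) / 2) ^ 2 * ampPlus α n t ^ 2) * h2

theorem sum_cosineCurve_mul (α : ℝ) (n : ℕ) (t : ℝ) :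
    ∑ i, cosineCurve α n t i * cosineCurve' α n t i =
      2 * (ampMinus α n t * ampMinus' α n t + ampPlus α n t * ampPlus' α n t) := by
  have h1 := Real.sin_sq_add_cos_sq (((n : ℝ) + 1) * ((t - α) / 2))
  have h2 := Real.sin_sq_add_cos_sq (((n : ℝ) + 1) * ((t + α) / 2))
  simp only [Fin.sum_univ_four, cosineCurve, cosineCurve', Matrix.cons_val_zero,
    Matrix.cons_val_one, Matrix.cons_val]
  linear_combination 2 * (ampMinus α n t * ampMinus' α n t) * h1 +
    2 * (ampPlus α n t * ampPlus' α n t) * h2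

/-- The normalised angular speed of the curve `(ampMinus, ampPlus)`. -/
noncomputable def angularSpeed (α : ℝ) (n : ℕ) (t : ℝ) : ℝ :=
  (Real.sin (n * α) * Real.sin ((t + α) / 2) * Real.sin ((t - α) / 2) -
    1 / n * (Real.sin α * Real.sin (n * ((t + α) / 2)) * Real.sin (n * ((t - α) / 2)))) /
  (ampMinus α n t ^ 2 + ampPlus α n t ^ 2)

theorem wronskian_amp (α : ℝ) {n : ℕ} (hn : n ≠ 0) (t : ℝ) :
    ampMinus α n t * ampPlus' α n t - ampPlus α n t * ampMinus' α n t =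
      -(n / 2 * (Real.sin (n * α) * Real.sin ((t + α) / 2) * Real.sin ((t - α) / 2) -
    1 / n * (Real.sin α * Real.sin (n * ((t + α) / 2)) * Real.sin (n * ((t - α) / 2))))) := by
  have e1 : Real.sin (n * α) = Real.sin (n * ((t + α) / 2)) * Real.cos (n * ((t - α) / 2)) -
      Real.cos (n * ((t + α) / 2)) * Real.sin (n * ((t - α) / 2)) := by
    rw [← Real.sin_sub]; congr 1; ring
  have e2 : Real.sin α = Real.sin ((t + α) / 2) * Real.cos ((t - α) / 2) -
      Real.cos ((t + α) / 2) * Real.sin ((t - α) / 2) := by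
    rw [← Real.sin_sub]; congr 1; ring
  have hn' : (n : ℝ) ≠ 0 := by exact_mod_cast hn
  rw [e1, e2]
  simp only [ampMinus, ampPlus, ampMinus', ampPlus']
  field_simp
  ring

/-- If both amplitudes vanished, `n (t + α)/2` and `n (t - α)/2` would be multiples of `π`, and so
would their difference `n α`. -/
theorem amp_sq_pos {α : ℝ} {n : ℕ} (hnα : Real.sin (n * α) ≠ 0) {t : ℝ}
    (hp : Real.sin ((t + α) / 2) ≠ 0) (hm : Real.sin ((t - α) / 2) ≠ 0) :
    0 < ampMinus α n t ^ 2 + ampPlus α n t ^ 2 := by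
  by_contra hcon
  have h1 : ampMinus α n t = 0 := by nlinarith [sq_nonneg (ampMinus α n t), sq_nonneg (ampPlus α n t)]
  have h2 : ampPlus α n t = 0 := by nlinarith [sq_nonneg (ampMinus α n t), sq_nonneg (ampPlus α n t)]
  have h1' := (mul_eq_zero.1 h1).resolve_right hp
  have h2' := (mul_eq_zero.1 h2).resolve_right hm
  apply hnα
  have : (n : ℝ) * α = n * ((t + α) / 2) - n * ((t - α) / 2) := by ring
  rw [this, Real.sin_sub, h1', h2']; ring

/-- By Lagrange's identity the Gram determinant of `(M, P)` and its derivative is the squared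
Wronskian; the rotation adds `((n + 1)/2)²` times the squared norm squared. -/
theorem kacRice_density_cosineCurve {α : ℝ} {n : ℕ} (hn : n ≠ 0) {t : ℝ}
    (h : 0 < ampMinus α n t ^ 2 + ampPlus α n t ^ 2) :
    1 / Real.pi * (√((∑ i, cosineCurve α n t i ^ 2) * (∑ i, cosineCurve' α n t i ^ 2) -
        (∑ i, cosineCurve α n t i * cosineCurve' α n t i) ^ 2) / (∑ i, cosineCurve α n t i ^ 2)) =
      n / (2 * Real.pi) * √((1 + 1 / n) ^ 2 + angularSpeed α n t ^ 2) := by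
  have hn' : (0 : ℝ) < n := by positivity
  have hw := wronskian_amp α hn t
  rw [sum_cosineCurve_sq, sum_cosineCurve'_sq, sum_cosineCurve_mul]
  rw [angularSpeed]
  set N := Real.sin (n * α) * Real.sin ((t + α) / 2) * Real.sin ((t - α) / 2) -
    1 / n * (Real.sin α * Real.sin (n * ((t + α) / 2)) * Real.sin (n * ((t - α) / 2)))
  set D := ampMinus α n t ^ 2 + ampPlus α n t ^ 2 with hD
  have e : 2 * D * (2 * (ampMinus' α n t ^ 2 + ampPlus' α n t ^ 2 + (((n : ℝ) + 1) / 2) ^ 2 * D)) -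
      (2 * (ampMinus α n t * ampMinus' α n t + ampPlus α n t * ampPlus' α n t)) ^ 2 =
      (n * D) ^ 2 * ((1 + 1 / n) ^ 2 + (N / D) ^ 2) := by
    have e1 : (n * D) ^ 2 * ((1 + 1 / (n : ℝ)) ^ 2 + (N / D) ^ 2) =
        4 * ((((n : ℝ) + 1) / 2) ^ 2 * D ^ 2 + (-(n / 2 * N)) ^ 2) := by
      field_simp; ring
    rw [e1, ← hw, hD]
    ring
  rw [e, Real.sqrt_mul (by positivity), Real.sqrt_sq (by positivity)]
  field_simp

/-- Where the scalar factor vanishes the closed form says nothing. There the sum or the difference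
of coordinates `0` and `3` is a sum of cosines all equal to `1`, that is `n`. -/
theorem cosineBasis_ne_zero {α : ℝ} {n : ℕ} (hn : n ≠ 0) (hnα : Real.sin (n * α) ≠ 0) (t : ℝ) :
    ∃ i, cosineBasis α n t i ≠ 0 := by
  by_contra! hcon
  have hn' : (n : ℝ) ≠ 0 := by exact_mod_cast hn
  by_cases hm : Real.sin ((t - α) / 2) = 0
  · have h := sum_cos_of_sin_eq_zero n hm
    have h0 := hcon 0
    have h3 := hcon 3
    simp only [cosineBasis, Matrix.cons_val_zero, Matrix.cons_val] at h0 h3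
    apply hn'
    rw [← h, ← add_zero (0 : ℝ)]
    nth_rewrite 1 [← h0]
    rw [← h3, ← Finset.sum_add_distrib]
    refine Finset.sum_congr rfl fun k _ => ?_
    rw [show (k : ℝ) * (2 * ((t - α) / 2)) = k * t - k * α by ring, Real.cos_sub]; ring
  by_cases hp : Real.sin ((t + α) / 2) = 0
  · have h := sum_cos_of_sin_eq_zero n hp
    have h0 := hcon 0
    have h3 := hcon 3
    simp only [cosineBasis, Matrix.cons_val_zero, Matrix.cons_val] at h0 h3
    apply hn'
    rw [← h, ← sub_zero (0 : ℝ)]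
    nth_rewrite 1 [← h0]
    rw [← h3, ← Finset.sum_sub_distrib]
    refine Finset.sum_congr rfl fun k _ => ?_
    rw [show (k : ℝ) * (2 * ((t + α) / 2)) = k * t + k * α by ring, Real.cos_add]; ring
  have hpos := amp_sq_pos hnα hp hm
  have hs := sum_cosineCurve_sq α n t
  have hz : ∑ i, cosineCurve α n t i ^ 2 = 0 :=
    Finset.sum_eq_zero fun i _ => by rw [← two_mul_sin_mul_sin_mul_cosineBasis, hcon i]; simp
  linarith

/-! ### Exact integral for the expected number of zeros -/

theorem ae_cosineTrigPoly_ne_zero {α : ℝ} {n : ℕ} (hn : n ≠ 0) (hnα : Real.sin (n * α) ≠ 0)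
    (t : ℝ) : ∀ᵐ g ∂(Measure.pi fun _ : Fin 4 => gaussianReal 0 1), cosineTrigPoly α n g t ≠ 0 := by
  obtain ⟨i, hi⟩ := cosineBasis_ne_zero hn hnα t
  have hv : (∑ i, cosineBasis α n t i ^ 2).toNNReal ≠ 0 := by
    have : 0 < ∑ i, cosineBasis α n t i ^ 2 :=
      Finset.sum_pos' (fun _ _ => sq_nonneg _) ⟨i, Finset.mem_univ i, by positivity⟩
    exact (Real.toNNReal_pos.2 this).ne'
  have hmap := map_sum_mul_pi_gaussianReal (cosineBasis α n t)
  have := nullSingletonClass_gaussianReal (μ := 0) hv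
  have h0 : ((Measure.pi fun _ : Fin 4 => gaussianReal 0 1).map
      fun g : Fin 4 → ℝ => ∑ i, g i * cosineBasis α n t i) {0} = 0 := by
    rw [hmap]; exact measure_singleton 0
  rw [Measure.map_apply_of_aemeasurable (hasGaussianLaw_sum_mul_pi _).aemeasurable
    (measurableSet_singleton 0)] at h0
  filter_upwards [measure_eq_zero_iff_ae_notMem.1 h0] with g hg
  rw [cosineTrigPoly_eq]
  have : (0 : ℝ) < n := by positivity
  exact mul_ne_zero (by positivity) hg

theorem countable_sin_half_eq_zero (α : ℝ) : {t : ℝ | Real.sin ((t + α) / 2) = 0}.Countable := by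
  refine (Set.countable_range fun j : ℤ => 2 * (j * Real.pi) - α).mono fun t ht => ?_
  obtain ⟨j, hj⟩ := Real.sin_eq_zero_iff.1 ht
  exact ⟨j, by simp only; linarith⟩

/-- The case `n = 1` is excluded because `cos α` may vanish; then `cos 2α = -1` serves instead. -/
theorem countable_cosineBasis_zero {α : ℝ} {n : ℕ} (hn : 2 ≤ n) :
    {t : ℝ | t ∈ Set.Icc 0 (2 * Real.pi) ∧ cosineBasis α n t 0 = 0}.Countable := by
  have hle := zeroCount_trigPoly_le (fun k => Real.cos (k * α)) (fun _ => 0) n (by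
    by_cases h : Real.cos α = 0
    · refine ⟨2, Finset.mem_Icc.2 ⟨one_le_two, hn⟩, Or.inl ?_⟩
      push_cast
      rw [Real.cos_two_mul, h]; norm_num
    · exact ⟨1, Finset.mem_Icc.2 ⟨le_rfl, by omega⟩, Or.inl (by simpa using h)⟩)
  have hfin : {t : ℝ | t ∈ Set.Icc 0 (2 * Real.pi) ∧
      trigPoly (fun k => Real.cos (k * α)) (fun _ => 0) n t = 0}.Finite := by
    rw [← Set.encard_ne_top_iff, ← ENat.toENNReal_ne_top]
    exact ne_top_of_le_ne_top (ENNReal.add_ne_top.2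
      ⟨ENNReal.mul_ne_top (by simp) (by simp), by simp⟩) hle
  refine (hfin.subset fun t ht => ⟨ht.1, ?_⟩).countable
  have h0 : ∑ k ∈ Finset.Icc 1 n, Real.cos (k * α) * Real.cos (k * t) = 0 := ht.2
  simp [trigPoly, h0]

theorem lintegral_zeroCount_cosineTrigPoly {α : ℝ} {n : ℕ} (hn : 2 ≤ n)
    (hnα : Real.sin (n * α) ≠ 0) :
    ∫⁻ g, zeroCount (cosineTrigPoly α n g) ∂(Measure.pi fun _ : Fin 4 => gaussianReal 0 1) =
      ∫⁻ t in Set.Ico 0 (2 * Real.pi), ENNReal.ofReal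
        (n / (2 * Real.pi) * √((1 + 1 / n) ^ 2 + angularSpeed α n t ^ 2)) := by
  have hn0 : n ≠ 0 := by omega
  have hn' : (0 : ℝ) < n := by positivity
  -- The times where the scalar factor vanishes, and those where coordinate `0`, the divisor in
  -- Kac-Rice, vanishes. A countable set is null for the integral and almost surely contains no zero
  -- of the polynomial.
  let Z : Set ℝ := {t | Real.sin ((t + α) / 2) = 0} ∪ {t | Real.sin ((t + -α) / 2) = 0} ∪
    {t | t ∈ Set.Icc 0 (2 * Real.pi) ∧ cosineBasis α n t 0 = 0}
  have hZ : Z.Countable := ((countable_sin_half_eq_zero α).union (countable_sin_half_eq_zero (-α))).union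
    (countable_cosineBasis_zero hn)
  let E : Set ℝ := Set.Icc 0 (2 * Real.pi) \ Z
  have hE : MeasurableSet E := measurableSet_Icc.diff hZ.measurableSet
  have hEp : ∀ t ∈ E, Real.sin ((t + α) / 2) ≠ 0 := fun t ht h => ht.2 (Or.inl (Or.inl h))
  have hEm : ∀ t ∈ E, Real.sin ((t - α) / 2) ≠ 0 := fun t ht h =>
    ht.2 (Or.inl (Or.inr (by simpa [sub_eq_add_neg] using h)))
  have hEc : ∀ t ∈ E, cosineCurve α n t 0 ≠ 0 := fun t ht h => by
    rw [← two_mul_sin_mul_sin_mul_cosineBasis] at h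
    have := (mul_eq_zero.1 h).resolve_left
      (mul_ne_zero two_ne_zero (mul_ne_zero (hEp t ht) (hEm t ht)))
    exact ht.2 (Or.inr ⟨ht.1, this⟩)
  have haeg : ∀ᵐ g ∂(Measure.pi fun _ : Fin 4 => gaussianReal 0 1), ∀ t ∈ Z,
      cosineTrigPoly α n g t ≠ 0 :=
    (ae_ball_iff hZ).2 fun t _ => ae_cosineTrigPoly_ne_zero hn0 hnα t
  have hcount : ∀ g : Fin 4 → ℝ, (∀ t ∈ Z, cosineTrigPoly α n g t ≠ 0) →
      zeroCount (cosineTrigPoly α n g) =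
        (({t : ℝ | t ∈ E ∧ g 0 * cosineCurve α n t 0 +
          ∑ i : Fin 3, g i.succ * cosineCurve α n t i.succ = 0}.encard : ℕ∞) : ℝ≥0∞) := by
    intro g hg
    rw [zeroCount]
    congr 2
    have hsum : ∀ t, g 0 * cosineCurve α n t 0 +
          ∑ i : Fin 3, g i.succ * cosineCurve α n t i.succ =
        2 * (Real.sin ((t + α) / 2) * Real.sin ((t - α) / 2)) *
          ∑ i, g i * cosineBasis α n t i := by
      intro t
      rw [← Fin.sum_univ_succ (f := fun i => g i * cosineCurve α n t i), Finset.mul_sum]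
      exact Finset.sum_congr rfl fun i _ => by
        rw [← two_mul_sin_mul_sin_mul_cosineBasis]; ring
    ext t
    constructor
    · rintro ⟨ht, h0⟩
      refine ⟨⟨ht, fun hZt => hg t hZt h0⟩, ?_⟩
      rw [cosineTrigPoly_eq] at h0
      have := (mul_eq_zero.1 h0).resolve_left (by positivity)
      rw [hsum, this, mul_zero]
    · rintro ⟨ht, h0⟩
      refine ⟨ht.1, ?_⟩
      rw [hsum] at h0
      have := (mul_eq_zero.1 h0).resolve_left
        (mul_ne_zero two_ne_zero (mul_ne_zero (hEp t ht) (hEm t ht)))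
      rw [cosineTrigPoly_eq, this, mul_zero]
  -- Coordinate `0` is split off, and the swap makes it the inner variable of integration.
  have hmp := ((measurePreserving_piFinSuccAbove (fun _ : Fin 4 => gaussianReal 0 1) 0).symm).comp
    (Measure.measurePreserving_swap (μ := Measure.pi fun _ : Fin 3 => gaussianReal 0 1)
      (ν := gaussianReal 0 1))
  have hae2 := Measure.ae_ae_of_ae_prod (hmp.quasiMeasurePreserving.ae haeg)
  rw [← hmp.lintegral_comp (measurable_zeroCount_cosineTrigPoly α n),
    lintegral_prod (fun p => zeroCount (cosineTrigPoly α n _))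
      ((measurable_zeroCount_cosineTrigPoly α n).comp hmp.measurable).aemeasurable]
  have hgoal := lintegral_encard_zeros_gaussian hE (hasStrictDerivAt_cosineCurve α n) hEc
  calc _ = ∫⁻ η : Fin 3 → ℝ, ∫⁻ x, (({t : ℝ | t ∈ E ∧ x * cosineCurve α n t 0 +
          ∑ i, η i * cosineCurve α n t (Fin.succ i) = 0}.encard : ℕ∞) : ℝ≥0∞)
          ∂(gaussianReal 0 1) ∂(Measure.pi fun _ => gaussianReal 0 1) := by
        refine lintegral_congr_ae ?_
        filter_upwards [hae2] with η hη
        refine lintegral_congr_ae ?_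
        filter_upwards [hη] with x hx
        exact hcount _ hx
    _ = _ := hgoal
    _ = ∫⁻ t in E, ENNReal.ofReal
          (n / (2 * Real.pi) * √((1 + 1 / n) ^ 2 + angularSpeed α n t ^ 2)) :=
        setLIntegral_congr_fun hE fun t ht => by
          rw [kacRice_density_cosineCurve hn0 (amp_sq_pos hnα (hEp t ht) (hEm t ht))]
    _ = _ := by
        refine setLIntegral_congr ?_
        refine (sdiff_null_ae_eq_self (hZ.measure_zero volume)).trans ?_
        exact Ico_ae_eq_Icc.symm

/-! ### Uniform bounds on the angular speed near `t = α` -/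

theorem abs_sin_nat_mul_le (n : ℕ) (y : ℝ) : |Real.sin (n * y)| ≤ n * |Real.sin y| := by
  induction n with
  | zero => simp
  | succ n ih =>
    push_cast
    rw [add_mul, one_mul, Real.sin_add]
    calc |Real.sin (n * y) * Real.cos y + Real.cos (n * y) * Real.sin y|
        ≤ |Real.sin (n * y)| * |Real.cos y| + |Real.cos (n * y)| * |Real.sin y| := by
          rw [← abs_mul, ← abs_mul]; exact abs_add_le _ _
      _ ≤ |Real.sin (n * y)| * 1 + 1 * |Real.sin y| := by
          gcongr
          · exact Real.abs_cos_le_one _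
          · exact Real.abs_cos_le_one _
      _ ≤ (n + 1) * |Real.sin y| := by linarith

/-- The two terms agree to first order at `y = 0`. This cancellation makes the numerator of the
angular speed vanish to second order. -/
theorem abs_nat_mul_cos_mul_sin_sub_le (n : ℕ) (y : ℝ) :
    |n * Real.cos (n * y) * Real.sin y - Real.sin (n * y) * Real.cos y| ≤
      n ^ 2 * Real.sin y ^ 2 := by
  induction n with
  | zero => simp
  | succ n ih =>
    have e : ((n + 1 : ℕ) : ℝ) * Real.cos ((n + 1 : ℕ) * y) * Real.sin y -
        Real.sin ((n + 1 : ℕ) * y) * Real.cos y =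
        (n * Real.cos (n * y) * Real.sin y - Real.sin (n * y) * Real.cos y) * Real.cos y +
          -((n + 1) * Real.sin (n * y) * Real.sin y ^ 2) := by
      push_cast
      rw [add_mul (n : ℝ) 1 y, one_mul, Real.sin_add, Real.cos_add]
      ring
    rw [e]
    calc _ ≤ |n * Real.cos (n * y) * Real.sin y - Real.sin (n * y) * Real.cos y| * |Real.cos y| +
          (n + 1) * |Real.sin (n * y)| * Real.sin y ^ 2 := by
          refine (abs_add_le _ _).trans ?_
          rw [abs_mul, abs_neg, abs_mul, abs_mul, abs_of_nonneg (by positivity : (0 : ℝ) ≤ n + 1),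
            abs_of_nonneg (sq_nonneg (Real.sin y))]
      _ ≤ (n ^ 2 * Real.sin y ^ 2) * 1 + (n + 1) * 1 * Real.sin y ^ 2 := by
          gcongr
          · exact Real.abs_cos_le_one _
          · exact Real.abs_sin_le_one _
      _ ≤ ((n + 1 : ℕ) : ℝ) ^ 2 * Real.sin y ^ 2 := by
          push_cast
          nlinarith [sq_nonneg (Real.sin y), mul_nonneg (Nat.cast_nonneg (α := ℝ) n)
            (sq_nonneg (Real.sin y))]

/-- If `r = n |sin y| < 1/4`, then `|cos (n y)| ≥ 9/10`, and the preceding cancellation gives `9 r /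
10 < r / 2 + r²`, which is impossible. -/
theorem one_le_four_mul_of_abs_sin_nat_mul_lt {n : ℕ} {y : ℝ}
    (h : |Real.sin (n * y)| < n * |Real.sin y| / 2) : 1 ≤ 4 * (n * |Real.sin y|) := by
  by_contra! hcon
  set r := (n : ℝ) * |Real.sin y| with hr
  have hr0 : 0 < r := by linarith [abs_nonneg (Real.sin (n * y))]
  have hD := abs_nat_mul_cos_mul_sin_sub_le n y
  have h1 : r * |Real.cos (n * y)| ≤ |Real.sin (n * y)| + r ^ 2 := by
    have e : r * |Real.cos (n * y)| = |n * Real.cos (n * y) * Real.sin y| := by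
      rw [abs_mul, abs_mul, Nat.abs_cast, hr]; ring
    have e2 : r ^ 2 = n ^ 2 * Real.sin y ^ 2 := by rw [hr, mul_pow, sq_abs]
    have h3 : |Real.sin (n * y) * Real.cos y| ≤ |Real.sin (n * y)| := by
      rw [abs_mul]
      exact mul_le_of_le_one_right (abs_nonneg _) (Real.abs_cos_le_one _)
    have h4 := abs_sub_abs_le_abs_sub (n * Real.cos (n * y) * Real.sin y)
      (Real.sin (n * y) * Real.cos y)
    rw [e, e2]; linarith
  have hc : (9 / 10 : ℝ) ≤ |Real.cos (n * y)| := by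
    refine le_of_sq_le_sq ?_ (abs_nonneg _)
    rw [sq_abs, Real.cos_sq']
    have h8 : |Real.sin (n * y)| ≤ 1 / 8 := by linarith
    have := sq_le_sq' (by linarith [abs_nonneg (Real.sin (n * y))]) h8
    rw [sq_abs] at this
    linarith
  nlinarith

theorem pow_three_mul_le (p q : ℝ) (hp : 0 ≤ p) (hq : 0 ≤ q) : p ^ 3 * q ≤ p ^ 4 + q ^ 4 := by
  rcases le_total q p with h | h
  · have : p ^ 3 * q ≤ p ^ 3 * p := by gcongr
    nlinarith [pow_nonneg hq 4]
  · have : p ^ 3 * q ≤ q ^ 3 * q := by gcongr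
    nlinarith [pow_nonneg hp 4]

/-- Interpolation between the bounds `1/|S|` and `|S|/σ²`: neither is integrable, but exponent `1/2`
on each variable is. -/
theorem abs_div_sq_add_sq_le {S σ : ℝ} (hS : S ≠ 0) (hσ : σ ≠ 0) :
    |S| / (σ ^ 2 + S ^ 2) ≤ (√|S|)⁻¹ * (√|σ|)⁻¹ := by
  have hp : 0 < √|S| := Real.sqrt_pos.2 (abs_pos.2 hS)
  have hq : 0 < √|σ| := Real.sqrt_pos.2 (abs_pos.2 hσ)
  have hp2 : √|S| ^ 2 = |S| := Real.sq_sqrt (abs_nonneg _)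
  have hq2 : √|σ| ^ 2 = |σ| := Real.sq_sqrt (abs_nonneg _)
  have h := pow_three_mul_le _ _ hp.le hq.le
  have e1 : σ ^ 2 + S ^ 2 = √|S| ^ 4 + √|σ| ^ 4 := by
    have a1 : √|S| ^ 4 = S ^ 2 := by rw [show 4 = 2 * 2 by rfl, pow_mul, hp2, sq_abs]
    have a2 : √|σ| ^ 4 = σ ^ 2 := by rw [show 4 = 2 * 2 by rfl, pow_mul, hq2, sq_abs]
    rw [a1, a2, add_comm]
  rw [e1, ← mul_inv, ← one_div, div_le_div_iff₀ (by positivity) (by positivity)]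
  nth_rewrite 1 [← hp2]
  linarith

section

variable {α : ℝ} {n : ℕ} {t : ℝ}

theorem sin_nat_mul_eq (α : ℝ) (n : ℕ) (t : ℝ) :
    Real.sin (n * α) = Real.sin (n * ((t + α) / 2)) * Real.cos (n * ((t - α) / 2)) -
      Real.cos (n * ((t + α) / 2)) * Real.sin (n * ((t - α) / 2)) := by
  rw [← Real.sin_sub]; congr 1; ring

theorem sin_eq_half (α t : ℝ) :
    Real.sin α = Real.sin ((t + α) / 2) * Real.cos ((t - α) / 2) -
      Real.cos ((t + α) / 2) * Real.sin ((t - α) / 2) := by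
  rw [← Real.sin_sub]; congr 1; ring

theorem sq_mul_sub_mul_le {a b c d : ℝ} (hc : c ^ 2 ≤ 1) (hd : d ^ 2 ≤ 1) :
    (a * c - d * b) ^ 2 ≤ 2 * (a ^ 2 + b ^ 2) := by
  have h1 : (a * c - d * b) ^ 2 ≤ 2 * ((a * c) ^ 2 + (d * b) ^ 2) := by
    nlinarith [sq_nonneg (a * c + d * b)]
  have h2 : (a * c) ^ 2 ≤ a ^ 2 := by
    rw [mul_pow]; exact mul_le_of_le_one_right (sq_nonneg _) hc
  have h3 : (d * b) ^ 2 ≤ b ^ 2 := by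
    rw [mul_pow]; exact mul_le_of_le_one_left (sq_nonneg _) hd
  linarith

theorem sin_sq_le_two_mul_half (α t : ℝ) :
    Real.sin α ^ 2 ≤ 2 * (Real.sin ((t + α) / 2) ^ 2 + Real.sin ((t - α) / 2) ^ 2) := by
  rw [sin_eq_half α t]
  exact sq_mul_sub_mul_le (Real.cos_sq_le_one _) (Real.cos_sq_le_one _)

/-- The phases `n (t ± α)/2` differ by `n α`, so both sines are small only if `sin (n α)` is. Thus
the denominator is bounded below uniformly as long as `sin (n α)` stays away from `0`. -/
theorem sin_nat_mul_sq_mul_le_amp (α : ℝ) (n : ℕ) (t : ℝ) :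
    Real.sin (n * α) ^ 2 * (Real.sin ((t + α) / 2) ^ 2 *
      (Real.sin (n * ((t - α) / 2)) ^ 2 + Real.sin ((t - α) / 2) ^ 2)) ≤
      3 * (ampMinus α n t ^ 2 + ampPlus α n t ^ 2) := by
  have h1 : Real.sin (n * α) ^ 2 ≤ 2 * (Real.sin (n * ((t + α) / 2)) ^ 2 +
      Real.sin (n * ((t - α) / 2)) ^ 2) := by
    rw [sin_nat_mul_eq α n t]
    exact sq_mul_sub_mul_le (Real.cos_sq_le_one _) (Real.cos_sq_le_one _)
  have h2 := Real.sin_sq_le_one (n * α)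
  have hP := Real.sin_sq_le_one ((t + α) / 2)
  have hS := Real.sin_sq_le_one ((t - α) / 2)
  simp only [ampMinus, ampPlus, mul_pow]
  set k := Real.sin (n * α) ^ 2
  set P := Real.sin ((t + α) / 2) ^ 2
  set S := Real.sin ((t - α) / 2) ^ 2
  set Q := Real.sin (n * ((t + α) / 2)) ^ 2
  set σ := Real.sin (n * ((t - α) / 2)) ^ 2
  have hP0 : 0 ≤ P := sq_nonneg _
  have hS0 : 0 ≤ S := sq_nonneg _
  have hQ0 : 0 ≤ Q := sq_nonneg _
  have hσ0 : 0 ≤ σ := sq_nonneg _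
  have e1 : k * (P * σ) ≤ 1 * (P * σ) := by gcongr
  have e2 : k * (P * S) ≤ 2 * (Q + σ) * (P * S) := by gcongr
  have e3 : Q * (P * S) ≤ Q * (1 * S) := by gcongr
  have e4 : σ * (P * S) ≤ σ * (P * 1) := by gcongr
  nlinarith

/-- The numerator of `angularSpeed`. -/
noncomputable def angularNum (α : ℝ) (n : ℕ) (t : ℝ) : ℝ :=
  Real.sin (n * α) * Real.sin ((t + α) / 2) * Real.sin ((t - α) / 2) -
    1 / n * (Real.sin α * Real.sin (n * ((t + α) / 2)) * Real.sin (n * ((t - α) / 2)))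

theorem inv_mul_abs_sin_le (n : ℕ) (y : ℝ) :
    1 / n * |Real.sin (n * y)| ≤ |Real.sin y| := by
  rcases Nat.eq_zero_or_pos n with rfl | hn
  · simp
  · have hn' : (0 : ℝ) < n := by exact_mod_cast hn
    rw [one_div, inv_mul_le_iff₀ hn']
    exact abs_sin_nat_mul_le n y

theorem abs_angularNum_le (α : ℝ) (n : ℕ) (t : ℝ) :
    |angularNum α n t| ≤ 2 * |Real.sin ((t - α) / 2)| := by
  rw [angularNum]
  refine (abs_sub _ _).trans ?_
  have h1 : |Real.sin (n * α) * Real.sin ((t + α) / 2) * Real.sin ((t - α) / 2)| ≤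
      1 * 1 * |Real.sin ((t - α) / 2)| := by
    rw [abs_mul, abs_mul]
    gcongr
    · exact Real.abs_sin_le_one _
    · exact Real.abs_sin_le_one _
  have h2 : |1 / n * (Real.sin α * Real.sin (n * ((t + α) / 2)) *
      Real.sin (n * ((t - α) / 2)))| ≤ 1 / n * (1 * 1 * |Real.sin (n * ((t - α) / 2))|) := by
    rw [abs_mul, abs_mul, abs_mul, abs_of_nonneg (by positivity : (0 : ℝ) ≤ 1 / n)]
    gcongr
    · exact Real.abs_sin_le_one _
    · exact Real.abs_sin_le_one _
  have h3 := inv_mul_abs_sin_le n ((t - α) / 2)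
  linarith

/-- Expanding `sin (n α)` and `sin α` through the half angles regroups the numerator into two
products, bounded by `n` and `2 n` times `sin² ((t - α)/2)`. -/
theorem abs_angularNum_le_sq (α : ℝ) {n : ℕ} (hn : n ≠ 0) (t : ℝ) :
    |angularNum α n t| ≤ 3 * n * Real.sin ((t - α) / 2) ^ 2 := by
  have hn' : (0 : ℝ) < n := by positivity
  have e : angularNum α n t =
      (Real.sin (n * ((t + α) / 2)) * Real.sin ((t + α) / 2)) *
        (1 / n * (n * Real.cos (n * ((t - α) / 2)) * Real.sin ((t - α) / 2) -
          Real.sin (n * ((t - α) / 2)) * Real.cos ((t - α) / 2))) -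
      (Real.sin (n * ((t - α) / 2)) * Real.sin ((t - α) / 2)) *
        (Real.cos (n * ((t + α) / 2)) * Real.sin ((t + α) / 2) -
          1 / n * Real.sin (n * ((t + α) / 2)) * Real.cos ((t + α) / 2)) := by
    rw [angularNum, sin_nat_mul_eq α n t, sin_eq_half α t]
    field_simp
    ring
  rw [e]
  refine (abs_sub _ _).trans ?_
  have h1 : |(Real.sin (n * ((t + α) / 2)) * Real.sin ((t + α) / 2)) *
        (1 / n * (n * Real.cos (n * ((t - α) / 2)) * Real.sin ((t - α) / 2) -
          Real.sin (n * ((t - α) / 2)) * Real.cos ((t - α) / 2)))| ≤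
      1 * 1 * (1 / n * (n ^ 2 * Real.sin ((t - α) / 2) ^ 2)) := by
    rw [abs_mul, abs_mul, abs_mul, abs_of_nonneg (by positivity : (0 : ℝ) ≤ 1 / n)]
    gcongr
    · exact Real.abs_sin_le_one _
    · exact Real.abs_sin_le_one _
    · exact abs_nat_mul_cos_mul_sin_sub_le _ _
  have h2 : |Real.cos (n * ((t + α) / 2)) * Real.sin ((t + α) / 2) -
          1 / n * Real.sin (n * ((t + α) / 2)) * Real.cos ((t + α) / 2)| ≤ 2 := by
    refine (abs_sub _ _).trans ?_
    have a1 : |Real.cos (n * ((t + α) / 2)) * Real.sin ((t + α) / 2)| ≤ 1 * 1 := by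
      rw [abs_mul]
      gcongr
      · exact Real.abs_cos_le_one _
      · exact Real.abs_sin_le_one _
    have a2 : |1 / n * Real.sin (n * ((t + α) / 2)) * Real.cos ((t + α) / 2)| ≤ 1 * 1 := by
      rw [abs_mul, abs_mul, abs_of_nonneg (by positivity : (0 : ℝ) ≤ 1 / n)]
      gcongr
      · exact (inv_mul_abs_sin_le n _).trans (Real.abs_sin_le_one _)
      · exact Real.abs_cos_le_one _
    linarith
  have h3 : |Real.sin (n * ((t - α) / 2)) * Real.sin ((t - α) / 2)| ≤
      n * Real.sin ((t - α) / 2) ^ 2 := by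
    rw [abs_mul, ← sq_abs (Real.sin ((t - α) / 2)), sq, ← mul_assoc]
    gcongr
    exact abs_sin_nat_mul_le _ _
  rw [abs_mul (Real.sin (n * ((t - α) / 2)) * Real.sin ((t - α) / 2))]
  have h4 : |Real.sin (n * ((t - α) / 2)) * Real.sin ((t - α) / 2)| *
      |Real.cos (n * ((t + α) / 2)) * Real.sin ((t + α) / 2) -
          1 / n * Real.sin (n * ((t + α) / 2)) * Real.cos ((t + α) / 2)| ≤
      n * Real.sin ((t - α) / 2) ^ 2 * 2 := by
    gcongr
  have h5 : 1 * 1 * (1 / (n : ℝ) * (n ^ 2 * Real.sin ((t - α) / 2) ^ 2)) =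
      n * Real.sin ((t - α) / 2) ^ 2 := by field_simp
  linarith

theorem sin_sq_mul_abs_angularSpeed_le_div (hnα : Real.sin (n * α) ≠ 0)
    (hσ : Real.sin (n * ((t - α) / 2)) ≠ 0) :
    Real.sin ((t + α) / 2) ^ 2 * |angularSpeed α n t| ≤
      3 / Real.sin (n * α) ^ 2 * (|angularNum α n t| /
        (Real.sin (n * ((t - α) / 2)) ^ 2 + Real.sin ((t - α) / 2) ^ 2)) := by
  have hk : 0 < Real.sin (n * α) ^ 2 := by positivity
  have hd : 0 < Real.sin (n * ((t - α) / 2)) ^ 2 + Real.sin ((t - α) / 2) ^ 2 := by positivity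
  have hamp := sin_nat_mul_sq_mul_le_amp α n t
  change Real.sin ((t + α) / 2) ^ 2 * |angularNum α n t /
    (ampMinus α n t ^ 2 + ampPlus α n t ^ 2)| ≤ _
  set Δ := ampMinus α n t ^ 2 + ampPlus α n t ^ 2 with hΔ
  have hΔ0 : 0 ≤ Δ := by positivity
  rw [abs_div, abs_of_nonneg hΔ0]
  -- If the denominator vanishes, the quotient is `0` by convention.
  rcases hΔ0.eq_or_lt with h0 | h0
  · rw [← h0]
    simp only [div_zero, mul_zero]
    positivity
  · rw [← mul_div_assoc, div_mul_div_comm, div_le_div_iff₀ h0 (by positivity)]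
    nlinarith [mul_le_mul_of_nonneg_left hamp (abs_nonneg (angularNum α n t))]

/-- Uniform bound for the angular speed near its singularity at `t = α`, with the numerator damped
at the other singularity. -/
theorem sin_sq_mul_abs_angularSpeed_le {s : ℝ} (hn : n ≠ 0) (hnα : Real.sin (n * α) ≠ 0)
    (hs : |s - (t - α)| ≤ 2 * Real.pi / n) (hs0 : Real.sin (s / 2) ≠ 0)
    (hσ : Real.sin (n * ((t - α) / 2)) ≠ 0) :
    Real.sin ((t + α) / 2) ^ 2 * |angularSpeed α n t| ≤
      3 / Real.sin (n * α) ^ 2 *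
        (12 + 8 * ((√|Real.sin (s / 2)|)⁻¹ * (√|Real.sin (n * ((t - α) / 2))|)⁻¹)) := by
  have hn' : (0 : ℝ) < n := by positivity
  have hn1 : (1 : ℝ) ≤ n := by exact_mod_cast Nat.one_le_iff_ne_zero.2 hn
  refine (sin_sq_mul_abs_angularSpeed_le_div hnα hσ).trans ?_
  have hk : 0 < Real.sin (n * α) ^ 2 := by positivity
  gcongr
  set y := (t - α) / 2 with hy
  have hS : Real.sin y ≠ 0 := by
    intro h
    have := abs_sin_nat_mul_le n y
    rw [h, abs_zero, mul_zero] at this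
    exact hσ (abs_eq_zero.1 (le_antisymm this (abs_nonneg _)))
  have hd : 0 < Real.sin (n * y) ^ 2 + Real.sin y ^ 2 := by positivity
  -- When `|sin (n y)|` is comparable to `n |sin y|`, the second-order bound suffices: `3 n sin² y ≤
  -- 3 n² sin² y ≤ 12 sin² (n y)`.
  rcases le_or_gt ((n : ℝ) * |Real.sin y| / 2) |Real.sin (n * y)| with hA | hB
  · have h1 : |angularNum α n t| / (Real.sin (n * y) ^ 2 + Real.sin y ^ 2) ≤ 12 := by
      rw [div_le_iff₀ hd]
      refine (abs_angularNum_le_sq α hn t).trans ?_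
      have h2 : (n * |Real.sin y| / 2) ^ 2 ≤ |Real.sin (n * y)| ^ 2 := by gcongr
      rw [sq_abs, div_pow, mul_pow, sq_abs] at h2
      have h3 : 3 * n * Real.sin y ^ 2 ≤ 3 * n ^ 2 * Real.sin y ^ 2 := by
        gcongr; nlinarith
      nlinarith [sq_nonneg (Real.sin y)]
    have h4 : 0 ≤ 8 * ((√|Real.sin (s / 2)|)⁻¹ * (√|Real.sin (n * y)|)⁻¹) := by positivity
    linarith
  -- Otherwise `1/n ≤ 4 |sin y|`, so `s/2` lies within `π/n ≤ 15 |sin y|` of `y` and `|sin (s/2)| ≤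
  -- 16 |sin y|`. Replacing `y` by `s/2` under the inverse square root costs a factor `4`.
  · have h1 := one_le_four_mul_of_abs_sin_nat_mul_lt hB
    have h2 : |Real.sin (s / 2)| ≤ 16 * |Real.sin y| := by
      have h3 : |Real.sin (s / 2) - Real.sin y| ≤ |s / 2 - y| := by
        have := Real.lipschitzWith_sin.dist_le_mul (s / 2) y
        simpa [Real.dist_eq] using this
      have h4 : |s / 2 - y| ≤ Real.pi / n := by
        rw [hy, show s / 2 - (t - α) / 2 = (s - (t - α)) / 2 by ring, abs_div, abs_two]
        have : 2 * Real.pi / n = 2 * (Real.pi / n) := by ring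
        linarith
      have h5 : Real.pi / n ≤ Real.pi * (4 * |Real.sin y|) := by
        rw [div_le_iff₀ hn']
        nlinarith [Real.pi_pos]
      have h6 := abs_sub_abs_le_abs_sub (Real.sin (s / 2)) (Real.sin y)
      have h7 : Real.pi * (4 * |Real.sin y|) ≤ 15 * |Real.sin y| := by
        nlinarith [Real.pi_lt_d2, abs_nonneg (Real.sin y)]
      linarith
    have h3 : (√|Real.sin y|)⁻¹ ≤ 4 * (√|Real.sin (s / 2)|)⁻¹ := by
      have hq : 0 < √|Real.sin (s / 2)| := Real.sqrt_pos.2 (abs_pos.2 hs0)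
      have hp : 0 < √|Real.sin y| := Real.sqrt_pos.2 (abs_pos.2 hS)
      have h4 : √|Real.sin (s / 2)| ≤ 4 * √|Real.sin y| := by
        calc √|Real.sin (s / 2)| ≤ √(16 * |Real.sin y|) := Real.sqrt_le_sqrt h2
          _ = 4 * √|Real.sin y| := by
            rw [Real.sqrt_mul (by norm_num), show (16 : ℝ) = 4 ^ 2 by norm_num,
              Real.sqrt_sq (by norm_num)]
      rw [inv_le_comm₀ hp (by positivity), mul_inv, inv_inv]
      linarith
    have h4 : |angularNum α n t| / (Real.sin (n * y) ^ 2 + Real.sin y ^ 2) ≤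
        2 * ((√|Real.sin y|)⁻¹ * (√|Real.sin (n * y)|)⁻¹) := by
      refine le_trans ?_ (mul_le_mul_of_nonneg_left (abs_div_sq_add_sq_le hS hσ) zero_le_two)
      rw [← mul_div_assoc 2]
      exact div_le_div_of_nonneg_right (abs_angularNum_le α n t) hd.le
    have h5 : (√|Real.sin y|)⁻¹ * (√|Real.sin (n * y)|)⁻¹ ≤
        4 * (√|Real.sin (s / 2)|)⁻¹ * (√|Real.sin (n * y)|)⁻¹ := by gcongr
    linarith

end

/-! ### Two-scale averaging over a period -/

theorem lintegral_Ico_zero_nat_mul {T : ℝ} (hT : 0 < T) (F : ℝ → ℝ≥0∞) (n : ℕ) :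
    ∫⁻ t in Set.Ico 0 (n * T), F t = ∑ j ∈ Finset.range n, ∫⁻ v in Set.Ico 0 T, F (j * T + v) := by
  induction n with
  | zero => simp
  | succ n ih =>
    rw [Finset.sum_range_succ, ← ih]
    have hle : (n : ℝ) * T ≤ (n + 1 : ℕ) * T := by push_cast; nlinarith
    rw [← Set.Ico_union_Ico_eq_Ico (by positivity : (0 : ℝ) ≤ n * T) hle,
      lintegral_union measurableSet_Ico (Set.Ico_disjoint_Ico_same)]
    congr 1
    have h := (measurePreserving_add_left (volume : Measure ℝ) (n * T)).setLIntegral_comp_preimage_emb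
      (measurableEmbedding_addLeft ((n : ℝ) * T)) F (Set.Ico (n * T) ((n + 1 : ℕ) * T))
    rw [← h]
    congr 2
    ext v
    simp only [Set.mem_preimage, Set.mem_Ico]
    push_cast
    constructor <;> rintro ⟨h1, h2⟩ <;> constructor <;> linarith

theorem lintegral_Ico_zero_eq_sum {T : ℝ} (hT : 0 < T) (F : ℝ → ℝ≥0∞) {n : ℕ} (hn : n ≠ 0) :
    ∫⁻ t in Set.Ico 0 T, F t =
      ENNReal.ofReal (1 / n) * ∑ j ∈ Finset.range n, ∫⁻ v in Set.Ico 0 T, F ((j * T + v) / n) := by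
  have hn' : (0 : ℝ) < n := by positivity
  rw [← lintegral_Ico_zero_nat_mul hT (fun r => F (r / n)) n,
    ← lintegral_const_mul' _ _ ENNReal.ofReal_ne_top]
  have himg : (fun r : ℝ => r / n) '' Set.Ico 0 (n * T) = Set.Ico 0 T := by
    ext t
    constructor
    · rintro ⟨r, hr, rfl⟩
      exact ⟨div_nonneg hr.1 hn'.le, by rw [div_lt_iff₀ hn']; linarith [hr.2]⟩
    · intro ht
      refine ⟨n * t, ⟨mul_nonneg hn'.le ht.1, by gcongr; exact ht.2⟩, ?_⟩
      field_simp
  rw [← himg, lintegral_image_eq_lintegral_abs_deriv_mul (f := fun r => r / (n : ℝ)) (f' := fun _ => 1 / (n : ℝ))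
    measurableSet_Ico (fun r _ => ((hasDerivAt_id r).div_const (n : ℝ)).hasDerivWithinAt)
    (fun r _ s _ h => (div_left_inj' hn'.ne').1 h)]
  refine lintegral_congr fun r => ?_
  rw [abs_of_nonneg (by positivity)]

/-- Writing the variable as a multiple of `T / n` plus a remainder, each averaged separately. -/
theorem lintegral_Ico_eq_lintegral_lintegral {T : ℝ} (hT : 0 < T) (F : ℝ → ℝ≥0∞) {n : ℕ}
    (hn : n ≠ 0) :
    ∫⁻ t in Set.Ico 0 T, F t = ENNReal.ofReal (1 / T) *
      ∫⁻ s in Set.Ico 0 T, ∫⁻ v in Set.Ico 0 T, F ((⌊n * s / T⌋ * T + v) / n) := by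
  have hn' : (0 : ℝ) < n := by positivity
  rw [lintegral_Ico_zero_eq_sum hT F hn,
    lintegral_Ico_zero_eq_sum hT (fun s => ∫⁻ v in Set.Ico 0 T, F ((⌊n * s / T⌋ * T + v) / n)) hn,
    ← mul_assoc, mul_comm (ENNReal.ofReal (1 / T)), mul_assoc]
  congr 1
  rw [Finset.mul_sum]
  refine Finset.sum_congr rfl fun j _ => ?_
  -- On the `j`-th cell of length `T / n` the floor is `j`, so the inner integral is constant there.
  have h : ∀ v' ∈ Set.Ico 0 T, ∫⁻ v in Set.Ico 0 T,
      F ((⌊(n : ℝ) * ((j * T + v') / n) / T⌋ * T + v) / n) =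
      ∫⁻ v in Set.Ico 0 T, F ((j * T + v) / n) := by
    intro v' hv'
    have hfl : ⌊(n : ℝ) * ((j * T + v') / n) / T⌋ = (j : ℤ) := by
      rw [Int.floor_eq_iff]
      have : (n : ℝ) * ((j * T + v') / n) / T = j + v' / T := by field_simp
      rw [this]
      have h1 : 0 ≤ v' / T := div_nonneg hv'.1 hT.le
      have h2 : v' / T < 1 := (div_lt_one hT).2 hv'.2
      push_cast
      constructor <;> linarith
    rw [hfl]
    simp
  rw [setLIntegral_congr_fun measurableSet_Ico h, setLIntegral_const, Real.volume_Ico, sub_zero,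
    mul_comm _ (ENNReal.ofReal T), ← mul_assoc, ← ENNReal.ofReal_mul (by positivity)]
  have : 1 / T * T = 1 := by field_simp
  rw [this, ENNReal.ofReal_one, one_mul]

theorem lintegral_Ico_add_of_periodic {T : ℝ} (hT : 0 < T) {F : ℝ → ℝ≥0∞}
    (hF : Function.Periodic F T) (c : ℝ) :
    ∫⁻ t in Set.Ico 0 T, F (t + c) = ∫⁻ t in Set.Ico 0 T, F t := by
  have h := (measurePreserving_add_right (volume : Measure ℝ) c).setLIntegral_comp_preimage_emb
      (measurableEmbedding_addRight c) F (Set.Ico c (c + T))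
  have hpre : (fun t => t + c) ⁻¹' Set.Ico c (c + T) = Set.Ico 0 T := by
    ext v
    simp only [Set.mem_preimage, Set.mem_Ico]
    constructor <;> rintro ⟨h1, h2⟩ <;> constructor <;> linarith
  rw [hpre] at h
  rw [h, setLIntegral_congr Ico_ae_eq_Ioc, setLIntegral_congr Ico_ae_eq_Ioc]
  have h0 := (isAddFundamentalDomain_Ioc hT c).setLIntegral_eq (isAddFundamentalDomain_Ioc hT 0) F
    hF.map_vadd_zmultiples
  rwa [zero_add] at h0

theorem sin_half_ne_zero_of_mem {s : ℝ} (hs : s ∈ Set.Ioo 0 (2 * Real.pi)) :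
    Real.sin (s / 2) ≠ 0 :=
  (Real.sin_pos_of_pos_of_lt_pi (by linarith [hs.1]) (by linarith [hs.2])).ne'

/-- Jordan's inequality `sin (r/2) ≥ r/π`, with `r` the distance to the nearer end of the interval.
-/
theorem inv_sqrt_abs_sin_half_le {s : ℝ} (hs : s ∈ Set.Ioo 0 (2 * Real.pi)) :
    (√|Real.sin (s / 2)|)⁻¹ ≤ √Real.pi * (s ^ (-(1 / 2) : ℝ) + (2 * Real.pi - s) ^ (-(1 / 2) : ℝ)) := by
  have hpi := Real.pi_pos
  have key : ∀ r : ℝ, 0 < r → r ≤ Real.pi → (√|Real.sin (r / 2)|)⁻¹ ≤ √Real.pi * r ^ (-(1 / 2) : ℝ) := by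
    intro r h0 h1
    have h2 := Real.mul_le_sin (x := r / 2) (by linarith) (by linarith)
    have h3 : r / Real.pi ≤ |Real.sin (r / 2)| := by
      refine le_trans (le_of_eq ?_) (h2.trans (le_abs_self _))
      field_simp
    rw [Real.rpow_neg h0.le, ← Real.sqrt_eq_rpow]
    calc (√|Real.sin (r / 2)|)⁻¹ ≤ (√(r / Real.pi))⁻¹ := by
          have : 0 < √(r / Real.pi) := Real.sqrt_pos.2 (by positivity)
          gcongr
      _ = √Real.pi * (√r)⁻¹ := by
          rw [Real.sqrt_div h0.le, inv_div, div_eq_mul_inv]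
  have hs2 : 0 < 2 * Real.pi - s := by linarith [hs.2]
  rcases le_total s Real.pi with h | h
  · refine (key s hs.1 h).trans ?_
    gcongr
    have : 0 ≤ (2 * Real.pi - s) ^ (-(1 / 2) : ℝ) := Real.rpow_nonneg hs2.le _
    linarith
  · have e : Real.sin (s / 2) = Real.sin ((2 * Real.pi - s) / 2) := by
      rw [← Real.sin_pi_sub]; congr 1; ring
    rw [e]
    refine (key (2 * Real.pi - s) hs2 (by linarith)).trans ?_
    gcongr
    have : 0 ≤ s ^ (-(1 / 2) : ℝ) := Real.rpow_nonneg hs.1.le _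
    linarith

theorem integrableOn_inv_sqrt_abs_sin_half :
    IntegrableOn (fun s : ℝ => (√|Real.sin (s / 2)|)⁻¹) (Set.Ico 0 (2 * Real.pi)) := by
  have hpi := Real.pi_pos
  have h1 : IntervalIntegrable (fun s : ℝ => s ^ (-(1 / 2) : ℝ)) volume 0 (2 * Real.pi) :=
    intervalIntegral.intervalIntegrable_rpow' (by norm_num)
  have h2 : IntervalIntegrable (fun s : ℝ => (2 * Real.pi - s) ^ (-(1 / 2) : ℝ)) volume 0
      (2 * Real.pi) := by
    have := (h1.comp_sub_left (2 * Real.pi)).symm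
    simpa using this
  have h3 := (intervalIntegrable_iff_integrableOn_Ioo_of_le (by positivity)).1
    ((h1.add h2).const_mul √Real.pi)
  rw [integrableOn_Ico_iff_integrableOn_Ioo]
  refine Integrable.mono' h3 (Measurable.aestronglyMeasurable (by fun_prop)) ?_
  filter_upwards [ae_restrict_mem measurableSet_Ioo] with s hs
  rw [Real.norm_of_nonneg (by positivity)]
  exact inv_sqrt_abs_sin_half_le hs

/-! ### Partition of unity separating the two singularities -/

/-- A weight vanishing at `t = -α` and equal to one at `t = α`. -/
noncomputable def dampWeight (α t : ℝ) : ℝ :=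
  Real.sin ((t + α) / 2) ^ 2 / (Real.sin ((t + α) / 2) ^ 2 + Real.sin ((t - α) / 2) ^ 2)

/-- The part near `t = α` of the normalised density of zeros. -/
noncomputable def dampedDensity (α : ℝ) (n : ℕ) (t : ℝ) : ℝ :=
  dampWeight α t * √((1 + 1 / n) ^ 2 + angularSpeed α n t ^ 2)

/-- The part near `s = α` of the integrand of `ell`. -/
noncomputable def dampedLimit (α x s u : ℝ) : ℝ := dampWeight α s * ellIntegrand α x (s, u)

theorem sin_half_add_two_pi (t c : ℝ) :
    Real.sin ((t + 2 * Real.pi + c) / 2) = -Real.sin ((t + c) / 2) := by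
  rw [← Real.sin_add_pi]; congr 1; ring

theorem sin_half_add_two_pi' (t c : ℝ) :
    Real.sin ((t + 2 * Real.pi - c) / 2) = -Real.sin ((t - c) / 2) := by
  rw [← Real.sin_add_pi]; congr 1; ring

theorem dampWeight_periodic (α : ℝ) : Function.Periodic (dampWeight α) (2 * Real.pi) := by
  intro t
  simp only [dampWeight, sin_half_add_two_pi, sin_half_add_two_pi', neg_sq]

theorem dampWeight_nonneg (α t : ℝ) : 0 ≤ dampWeight α t := by
  unfold dampWeight; positivity

theorem dampWeight_le_one (α t : ℝ) : dampWeight α t ≤ 1 :=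
  div_le_one_of_le₀ (by linarith [sq_nonneg (Real.sin ((t - α) / 2))]) (by positivity)

theorem dampWeight_den_pos {α : ℝ} (hα : Real.sin α ≠ 0) (t : ℝ) :
    0 < Real.sin ((t + α) / 2) ^ 2 + Real.sin ((t - α) / 2) ^ 2 := by
  have h1 := sin_sq_le_two_mul_half α t
  have h2 : 0 < Real.sin α ^ 2 := by positivity
  linarith

theorem dampWeight_add_neg {α : ℝ} (hα : Real.sin α ≠ 0) (t : ℝ) :
    dampWeight α t + dampWeight (-α) t = 1 := by
  have h := dampWeight_den_pos hα t
  simp only [dampWeight, sub_neg_eq_add, ← sub_eq_add_neg]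
  rw [add_comm (Real.sin ((t - α) / 2) ^ 2), ← add_div, div_self h.ne']

theorem angularSpeed_neg_sq (α : ℝ) (n : ℕ) (t : ℝ) :
    angularSpeed (-α) n t ^ 2 = angularSpeed α n t ^ 2 := by
  simp only [angularSpeed, ampMinus, ampPlus, sub_neg_eq_add, ← sub_eq_add_neg, mul_neg,
    Real.sin_neg]
  rw [div_pow, div_pow, ← neg_sq]
  congr 1
  · ring
  · ring

theorem dampedDensity_add_neg {α : ℝ} (hα : Real.sin α ≠ 0) (n : ℕ) (t : ℝ) :
    dampedDensity α n t + dampedDensity (-α) n t = √((1 + 1 / n) ^ 2 + angularSpeed α n t ^ 2) := by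
  rw [dampedDensity, dampedDensity, angularSpeed_neg_sq, ← add_mul, dampWeight_add_neg hα, one_mul]

theorem gFun_neg_neg (α x s u : ℝ) : gFun (-α) (-x) s u = -gFun α x s u := by
  simp only [gFun, sub_neg_eq_add, ← sub_eq_add_neg, Real.sin_neg]
  rw [← neg_div]
  congr 1
  · ring
  · ring

theorem dampedLimit_add_neg {α : ℝ} (hα : Real.sin α ≠ 0) (x s u : ℝ) :
    dampedLimit α x s u + dampedLimit (-α) (-x) s u = ellIntegrand α x (s, u) := by
  have : ellIntegrand (-α) (-x) (s, u) = ellIntegrand α x (s, u) := by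
    simp only [ellIntegrand, gFun_neg_neg, abs_neg]
  rw [dampedLimit, dampedLimit, this, ← add_mul, dampWeight_add_neg hα, one_mul]

theorem angularSpeed_sq_periodic (α : ℝ) (n : ℕ) :
    Function.Periodic (fun t => angularSpeed α n t ^ 2) (2 * Real.pi) := by
  intro t
  have h1 : ∀ c : ℝ, Real.sin (n * ((t + 2 * Real.pi + c) / 2)) =
      (-1) ^ n * Real.sin (n * ((t + c) / 2)) := by
    intro c
    rw [← Real.sin_add_nat_mul_pi]; congr 1; ring
  have h2 : ∀ c : ℝ, Real.sin (n * ((t + 2 * Real.pi - c) / 2)) =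
      (-1) ^ n * Real.sin (n * ((t - c) / 2)) := by
    intro c
    rw [← Real.sin_add_nat_mul_pi]; congr 1; ring
  have h3 : ((-1 : ℝ) ^ n) ^ 2 = 1 := by rw [← pow_mul, mul_comm, pow_mul]; simp
  simp only [angularSpeed, ampMinus, ampPlus, sin_half_add_two_pi, sin_half_add_two_pi', h1, h2]
  congr 2
  · linear_combination -(1 / (n : ℝ) * (Real.sin α * Real.sin (n * ((t + α) / 2)) *
      Real.sin (n * ((t - α) / 2)))) * h3
  · linear_combination ((Real.sin (n * ((t - α) / 2)) * Real.sin ((t + α) / 2)) ^ 2 +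
      (Real.sin (n * ((t + α) / 2)) * Real.sin ((t - α) / 2)) ^ 2) * h3

theorem dampedDensity_periodic (α : ℝ) (n : ℕ) :
    Function.Periodic (dampedDensity α n) (2 * Real.pi) := by
  intro t
  have h := angularSpeed_sq_periodic α n t
  simp only at h
  rw [dampedDensity, dampedDensity, dampWeight_periodic α t, h]

theorem dampedLimit_periodic_left (α x u : ℝ) :
    Function.Periodic (fun s => dampedLimit α x s u) (2 * Real.pi) := by
  intro s
  simp only [dampedLimit, dampWeight_periodic α s, ellIntegrand, gFun, sin_half_add_two_pi,
    sin_half_add_two_pi', neg_sq, mul_neg, neg_mul, neg_neg]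

theorem dampedLimit_periodic_right (α x s : ℝ) :
    Function.Periodic (fun u => dampedLimit α x s u) (2 * Real.pi) := by
  intro u
  simp only [dampedLimit, ellIntegrand, gFun, sin_half_add_two_pi,
    sin_half_add_two_pi', neg_sq]

theorem measurable_angularSpeed (α : ℝ) (n : ℕ) : Measurable (angularSpeed α n) := by
  unfold angularSpeed ampMinus ampPlus; fun_prop

theorem measurable_dampedDensity (α : ℝ) (n : ℕ) : Measurable (dampedDensity α n) := by
  have := measurable_angularSpeed α n
  unfold dampedDensity dampWeight; fun_prop

theorem measurable_ellIntegrand (α x : ℝ) : Measurable (ellIntegrand α x) := by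
  unfold ellIntegrand gFun; fun_prop

theorem measurable_dampedLimit (α x : ℝ) :
    Measurable fun p : ℝ × ℝ => dampedLimit α x p.1 p.2 := by
  have := measurable_ellIntegrand α x
  unfold dampedLimit dampWeight; fun_prop

theorem sqrt_sq_add_sq_le {a : ℝ} (ha : 0 ≤ a) (b : ℝ) : √(a ^ 2 + b ^ 2) ≤ a + |b| := by
  rw [Real.sqrt_le_left (by positivity)]
  nlinarith [sq_abs b, mul_nonneg ha (abs_nonneg b)]

/-- The weight contributes the factor that damps the singularity at `-α`; its denominator is at
least `sin² α / 2`. -/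
theorem dampedDensity_le {α : ℝ} (hα : Real.sin α ≠ 0) {n : ℕ} (hn : n ≠ 0) (t : ℝ) :
    dampedDensity α n t ≤ 2 + 2 / Real.sin α ^ 2 *
      (Real.sin ((t + α) / 2) ^ 2 * |angularSpeed α n t|) := by
  have hn1 : (1 : ℝ) ≤ n := by exact_mod_cast Nat.one_le_iff_ne_zero.2 hn
  have h1n : 1 / (n : ℝ) ≤ 1 := by rw [div_le_one (by linarith)]; exact hn1
  have hden := dampWeight_den_pos hα t
  have hs : 0 < Real.sin α ^ 2 := by positivity
  calc dampedDensity α n t ≤ dampWeight α t * ((1 + 1 / n) + |angularSpeed α n t|) := by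
        rw [dampedDensity]
        gcongr
        · exact dampWeight_nonneg α t
        · exact sqrt_sq_add_sq_le (by positivity) _
    _ = dampWeight α t * (1 + 1 / n) + dampWeight α t * |angularSpeed α n t| := by ring
    _ ≤ 1 * (1 + 1) + 2 / Real.sin α ^ 2 * (Real.sin ((t + α) / 2) ^ 2 * |angularSpeed α n t|) := by
        refine add_le_add ?_ ?_
        · gcongr
          exact dampWeight_le_one α t
        · rw [← mul_assoc]
          refine mul_le_mul_of_nonneg_right ?_ (abs_nonneg _)
          rw [dampWeight, div_mul_eq_mul_div, div_le_div_iff₀ hden hs]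
          nlinarith [mul_le_mul_of_nonneg_left (sin_sq_le_two_mul_half α t)
            (sq_nonneg (Real.sin ((t + α) / 2)))]
    _ = _ := by ring

/-! ### Grid points and the pointwise limit -/

/-- The point of `[0, 2π]` near `s` whose `n`-th multiple is `v` modulo `2π`. -/
noncomputable def gridPoint (n : ℕ) (s v : ℝ) : ℝ :=
  (⌊n * s / (2 * Real.pi)⌋ * (2 * Real.pi) + v) / n

theorem abs_sub_gridPoint_le {n : ℕ} (hn : n ≠ 0) (s : ℝ) {v : ℝ}
    (hv : v ∈ Set.Icc 0 (2 * Real.pi)) : |s - gridPoint n s v| ≤ 2 * Real.pi / n := by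
  have hn' : (0 : ℝ) < n := by positivity
  have hpi := Real.pi_pos
  have h1 := Int.floor_le ((n : ℝ) * s / (2 * Real.pi))
  have h2 := Int.lt_floor_add_one ((n : ℝ) * s / (2 * Real.pi))
  rw [le_div_iff₀ (by positivity)] at h1
  rw [div_lt_iff₀ (by positivity)] at h2
  have e : s - gridPoint n s v =
      (n * s - (⌊(n : ℝ) * s / (2 * Real.pi)⌋ * (2 * Real.pi) + v)) / n := by
    rw [gridPoint]; field_simp
  rw [e, abs_div, abs_of_pos hn']
  gcongr
  rw [abs_le]
  constructor <;> linarith [hv.1, hv.2]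

theorem nat_mul_gridPoint {n : ℕ} (hn : n ≠ 0) (s v : ℝ) :
    ∃ j : ℤ, n * (gridPoint n s v / 2) = v / 2 + j * Real.pi := by
  have hn' : (n : ℝ) ≠ 0 := by exact_mod_cast hn
  refine ⟨⌊(n : ℝ) * s / (2 * Real.pi)⌋, ?_⟩
  rw [gridPoint]; field_simp; ring

theorem abs_sin_add_int_mul_pi (y : ℝ) (j : ℤ) : |Real.sin (y + j * Real.pi)| = |Real.sin y| := by
  rw [Real.sin_add, Real.sin_int_mul_pi, mul_zero, add_zero, abs_mul, Real.abs_cos_int_mul_pi,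
    mul_one]

theorem sin_sq_add_int_mul_pi (y : ℝ) (j : ℤ) :
    Real.sin (y + j * Real.pi) ^ 2 = Real.sin y ^ 2 := by
  rw [← sq_abs, abs_sin_add_int_mul_pi, sq_abs]

theorem measurable_gridPoint (n : ℕ) : Measurable fun p : ℝ × ℝ => gridPoint n p.1 p.2 := by
  unfold gridPoint; fun_prop

theorem dampedDensity_gridPoint_le {α : ℝ} (hα : Real.sin α ≠ 0) {n : ℕ} (hn : n ≠ 0)
    (hnα : Real.sin (n * α) ≠ 0) {s v : ℝ} (hs : s ∈ Set.Ioo 0 (2 * Real.pi))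
    (hv : v ∈ Set.Ioo 0 (2 * Real.pi)) :
    dampedDensity α n (gridPoint n s v + α) ≤ 2 + 2 / Real.sin α ^ 2 * (3 / Real.sin (n * α) ^ 2 *
      (12 + 8 * ((√|Real.sin (s / 2)|)⁻¹ * (√|Real.sin (v / 2)|)⁻¹))) := by
  refine (dampedDensity_le hα hn _).trans ?_
  refine add_le_add le_rfl (mul_le_mul_of_nonneg_left ?_ (by positivity))
  obtain ⟨j, hj⟩ := nat_mul_gridPoint hn s v
  have e : |Real.sin (n * ((gridPoint n s v + α - α) / 2))| = |Real.sin (v / 2)| := by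
    rw [add_sub_cancel_right, hj, abs_sin_add_int_mul_pi]
  rw [← e]
  refine sin_sq_mul_abs_angularSpeed_le hn hnα ?_ (sin_half_ne_zero_of_mem hs) ?_
  · rw [add_sub_cancel_right]
    exact abs_sub_gridPoint_le hn s (Set.Ioo_subset_Icc_self hv)
  · rw [← abs_pos, e, abs_pos]
    exact sin_half_ne_zero_of_mem hv

/-- Modulo `π`, the phases `n (t - α)/2` and `n (t + α)/2` are `v/2` and `v/2 + y i`. Only squares
of their sines enter the denominator, and the term carrying `1/n` in the numerator disappears. The
sign `cos (m i π)` relating `sin (n α)` to `sin (y i)` is why the limit is stated for squares. -/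
theorem tendsto_angularSpeed_sq {α x : ℝ} {s v : ℝ} {ν : ℕ → ℕ} (hν : Tendsto ν atTop atTop)
    {y : ℕ → ℝ} (hy : Tendsto y atTop (𝓝 x)) (hνy : ∀ i, ∃ m : ℤ, ν i * α = y i + m * Real.pi)
    (hv : v ∈ Set.Ioo 0 (2 * Real.pi)) (hs : Real.sin ((s + α + α) / 2) ≠ 0)
    {τ : ℕ → ℝ} (hτ : Tendsto τ atTop (𝓝 s))
    (hτv : ∀ᶠ i in atTop, ∃ j : ℤ, ν i * (τ i / 2) = v / 2 + j * Real.pi) :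
    Tendsto (fun i => angularSpeed α (ν i) (τ i + α) ^ 2) atTop
      (𝓝 (gFun α x (s + α) (v + x) ^ 2)) := by
  choose m hm using hνy
  have hinv : Tendsto (fun i => 1 / (ν i : ℝ)) atTop (𝓝 0) :=
    tendsto_one_div_atTop_nhds_zero_nat.comp hν
  let R : ℕ → ℝ := fun i => Real.cos (m i * Real.pi) * (Real.sin α *
    Real.sin (ν i * ((τ i + α + α) / 2)) * Real.sin (ν i * ((τ i + α - α) / 2)))
  have hR : Tendsto (fun i => 1 / (ν i : ℝ) * R i) atTop (𝓝 0) := by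
    refine squeeze_zero_norm (fun i => ?_) hinv
    rw [Real.norm_eq_abs, abs_mul, abs_of_nonneg (by positivity : 0 ≤ 1 / (ν i : ℝ))]
    refine mul_le_of_le_one_right (by positivity) ?_
    simp only [R]
    rw [abs_mul, abs_mul, abs_mul, Real.abs_cos_int_mul_pi, one_mul]
    exact mul_le_one₀ (mul_le_one₀ (Real.abs_sin_le_one _) (abs_nonneg _) (Real.abs_sin_le_one _))
      (abs_nonneg _) (Real.abs_sin_le_one _)
  have hden : Real.sin (v / 2) ^ 2 * Real.sin ((s + α + α) / 2) ^ 2 +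
      Real.sin ((v + x + x) / 2) ^ 2 * Real.sin (s / 2) ^ 2 ≠ 0 := by
    have h1 := sin_half_ne_zero_of_mem hv
    have : 0 < Real.sin (v / 2) ^ 2 * Real.sin ((s + α + α) / 2) ^ 2 := by positivity
    positivity
  have hP : Tendsto (fun i => Real.sin ((τ i + α + α) / 2)) atTop (𝓝 (Real.sin ((s + α + α) / 2))) :=
    (Real.continuous_sin.tendsto _).comp (((hτ.add_const α).add_const α).div_const 2)
  have hS : Tendsto (fun i => Real.sin (τ i / 2)) atTop (𝓝 (Real.sin (s / 2))) :=
    (Real.continuous_sin.tendsto _).comp (hτ.div_const 2)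
  have hQ : Tendsto (fun i => Real.sin (v / 2 + y i)) atTop (𝓝 (Real.sin ((v + x + x) / 2))) := by
    rw [show (v + x + x) / 2 = v / 2 + x by ring]
    exact (Real.continuous_sin.tendsto _).comp (hy.const_add _)
  have hsy : Tendsto (fun i => Real.sin (y i)) atTop (𝓝 (Real.sin x)) :=
    (Real.continuous_sin.tendsto _).comp hy
  have hlim := ((((hsy.mul hP).mul hS).sub hR).div
    ((hP.pow 2).const_mul (Real.sin (v / 2) ^ 2) |>.add ((hQ.pow 2).mul (hS.pow 2))) hden).pow 2
  have hgoal : gFun α x (s + α) (v + x) ^ 2 =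
      ((Real.sin x * Real.sin ((s + α + α) / 2) * Real.sin (s / 2) - 0) /
        (Real.sin (v / 2) ^ 2 * Real.sin ((s + α + α) / 2) ^ 2 +
          Real.sin ((v + x + x) / 2) ^ 2 * Real.sin (s / 2) ^ 2)) ^ 2 := by
    simp only [gFun, add_sub_cancel_right, sub_zero]
    congr 2
    ring
  rw [hgoal]
  refine hlim.congr' ?_
  filter_upwards [hτv] with i hi
  obtain ⟨j, hj⟩ := hi
  have hsin : Real.sin (ν i * α) = Real.cos (m i * Real.pi) * Real.sin (y i) := by
    rw [hm i, Real.sin_add, Real.sin_int_mul_pi]; ring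
  have hcos : Real.cos (m i * Real.pi) ^ 2 = 1 := by
    rw [← sq_abs, Real.abs_cos_int_mul_pi, one_pow]
  have hσ : Real.sin (ν i * (τ i / 2)) ^ 2 = Real.sin (v / 2) ^ 2 := by
    rw [hj, sin_sq_add_int_mul_pi]
  have hQi : Real.sin (ν i * ((τ i + α + α) / 2)) ^ 2 = Real.sin (v / 2 + y i) ^ 2 := by
    have : (ν i : ℝ) * ((τ i + α + α) / 2) = v / 2 + y i + ((m i + j : ℤ) : ℝ) * Real.pi := by
      push_cast
      linear_combination hj + hm i
    rw [this, sin_sq_add_int_mul_pi]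
  simp only [angularSpeed, ampMinus, ampPlus, mul_pow, hσ, hQi, hsin, add_sub_cancel_right, R,
    Pi.div_apply]
  rw [div_pow, div_pow]
  congr 1
  linear_combination (-(Real.sin (y i) * Real.sin ((τ i + α + α) / 2) * Real.sin (τ i / 2)) ^ 2 +
    (1 / (ν i : ℝ) * (Real.sin α * Real.sin (ν i * ((τ i + α + α) / 2)) *
      Real.sin (ν i * (τ i / 2)))) ^ 2) * hcos

theorem tendsto_gridPoint {ν : ℕ → ℕ} (hν : Tendsto ν atTop atTop) (s : ℝ) {v : ℝ}
    (hv : v ∈ Set.Icc 0 (2 * Real.pi)) :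
    Tendsto (fun i => gridPoint (ν i) s v) atTop (𝓝 s) := by
  have h0 : Tendsto (fun i => 2 * Real.pi / (ν i : ℝ)) atTop (𝓝 0) :=
    (tendsto_const_div_atTop_nhds_zero_nat _).comp hν
  rw [tendsto_iff_norm_sub_tendsto_zero]
  refine squeeze_zero' (Eventually.of_forall fun i => norm_nonneg _) ?_ h0
  filter_upwards [hν.eventually_ne_atTop 0] with i hi
  rw [Real.norm_eq_abs, abs_sub_comm]
  exact abs_sub_gridPoint_le hi s hv

theorem tendsto_dampedDensity_gridPoint {α x : ℝ} (hα : Real.sin α ≠ 0) {s v : ℝ} {ν : ℕ → ℕ}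
    (hν : Tendsto ν atTop atTop) {y : ℕ → ℝ} (hy : Tendsto y atTop (𝓝 x))
    (hνy : ∀ i, ∃ m : ℤ, ν i * α = y i + m * Real.pi)
    (hv : v ∈ Set.Ioo 0 (2 * Real.pi)) (hs : Real.sin ((s + α + α) / 2) ≠ 0) :
    Tendsto (fun i => dampedDensity α (ν i) (gridPoint (ν i) s v + α)) atTop
      (𝓝 (dampedLimit α x (s + α) (v + x))) := by
  have hτ := tendsto_gridPoint hν s (Set.Ioo_subset_Icc_self hv)
  have hA := tendsto_angularSpeed_sq hν hy hνy hv hs hτ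
    ((hν.eventually_ne_atTop 0).mono fun i hi => nat_mul_gridPoint hi s v)
  have hinv : Tendsto (fun i => 1 / (ν i : ℝ)) atTop (𝓝 0) :=
    tendsto_one_div_atTop_nhds_zero_nat.comp hν
  have hw : Tendsto (fun i => dampWeight α (gridPoint (ν i) s v + α)) atTop
      (𝓝 (dampWeight α (s + α))) := by
    have hc : Continuous (dampWeight α) := by
      unfold dampWeight
      exact Continuous.div (by fun_prop) (by fun_prop) fun t => (dampWeight_den_pos hα t).ne'
    exact (hc.tendsto _).comp (hτ.add_const α)
  have hq := (((hinv.const_add 1).pow 2).add hA).sqrt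
  have := hw.mul hq
  simpa [dampedDensity, dampedLimit, ellIntegrand, sq_abs] using this

/-! ### Dominated convergence -/

theorem ae_ne_and_sin_half_ne_zero (α : ℝ) :
    ∀ᵐ s ∂(volume.restrict (Set.Ico 0 (2 * Real.pi))),
      s ∈ Set.Ioo 0 (2 * Real.pi) ∧ Real.sin ((s + α) / 2) ≠ 0 := by
  have h0 : ∀ᵐ s ∂(volume.restrict (Set.Ico 0 (2 * Real.pi))), s ≠ 0 :=
    (Measure.ae_ne volume 0).filter_mono (ae_mono Measure.restrict_le_self)
  have h1 : ∀ᵐ s ∂(volume.restrict (Set.Ico 0 (2 * Real.pi))), Real.sin ((s + α) / 2) ≠ 0 :=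
    ((countable_sin_half_eq_zero α).ae_notMem volume).filter_mono
      (ae_mono Measure.restrict_le_self)
  filter_upwards [h0, h1, ae_restrict_mem measurableSet_Ico] with s h0 h1 h2
  exact ⟨⟨lt_of_le_of_ne h2.1 h0.symm, h2.2⟩, h1⟩

theorem lintegral_prod_add_of_periodic {T : ℝ} (hT : 0 < T) {F : ℝ × ℝ → ℝ≥0∞}
    (hF : Measurable F) (hL : ∀ u, Function.Periodic (fun s => F (s, u)) T)
    (hR : ∀ s, Function.Periodic (fun u => F (s, u)) T) (c d : ℝ) :
    ∫⁻ p, F (p.1 + c, p.2 + d)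
        ∂((volume.restrict (Set.Ico 0 T)).prod (volume.restrict (Set.Ico 0 T))) =
      ∫⁻ p, F p ∂((volume.restrict (Set.Ico 0 T)).prod (volume.restrict (Set.Ico 0 T))) := by
  have hm' : Measurable fun p : ℝ × ℝ => F (p.1 + c, p.2 + d) :=
    hF.comp ((measurable_fst.add_const c).prodMk (measurable_snd.add_const d))
  have hLint : Function.Periodic (fun s => ∫⁻ u in Set.Ico 0 T, F (s, u)) T := fun s =>
    lintegral_congr fun u => hL u s
  rw [lintegral_prod _ hm'.aemeasurable, lintegral_prod _ hF.aemeasurable,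
    ← lintegral_Ico_add_of_periodic hT hLint c]
  exact lintegral_congr fun s => lintegral_Ico_add_of_periodic hT (hR (s + c)) d

theorem lintegral_dampedLimit_shift (α x : ℝ) :
    ∫⁻ p, ENNReal.ofReal (dampedLimit α x (p.1 + α) (p.2 + x))
        ∂((volume.restrict (Set.Ico 0 (2 * Real.pi))).prod
          (volume.restrict (Set.Ico 0 (2 * Real.pi)))) =
      ∫⁻ p, ENNReal.ofReal (dampedLimit α x p.1 p.2)
        ∂((volume.restrict (Set.Ico 0 (2 * Real.pi))).prod
          (volume.restrict (Set.Ico 0 (2 * Real.pi)))) := by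
  have hL (u : ℝ) := (dampedLimit_periodic_left α x u).comp ENNReal.ofReal
  have hR (s : ℝ) := (dampedLimit_periodic_right α x s).comp ENNReal.ofReal
  exact lintegral_prod_add_of_periodic Real.two_pi_pos
    (F := fun p => ENNReal.ofReal (dampedLimit α x p.1 p.2))
    (measurable_dampedLimit α x).ennreal_ofReal hL hR α x

theorem tendsto_lintegral_dampedDensity {α x : ℝ} (hα : Real.sin α ≠ 0) (hx : Real.sin x ≠ 0)
    {ν : ℕ → ℕ} (hν : Tendsto ν atTop atTop) {y : ℕ → ℝ} (hy : Tendsto y atTop (𝓝 x))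
    (hνy : ∀ i, ∃ m : ℤ, ν i * α = y i + m * Real.pi) :
    Tendsto (fun i => ∫⁻ t in Set.Ico 0 (2 * Real.pi), ENNReal.ofReal (dampedDensity α (ν i) t))
      atTop (𝓝 (ENNReal.ofReal (1 / (2 * Real.pi)) *
        ∫⁻ p, ENNReal.ofReal (dampedLimit α x p.1 p.2)
          ∂((volume.restrict (Set.Ico 0 (2 * Real.pi))).prod
            (volume.restrict (Set.Ico 0 (2 * Real.pi)))))) ∧
    ∫⁻ p, ENNReal.ofReal (dampedLimit α x p.1 p.2)
      ∂((volume.restrict (Set.Ico 0 (2 * Real.pi))).prod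
        (volume.restrict (Set.Ico 0 (2 * Real.pi)))) ≠ ∞ := by
  rw [← lintegral_dampedLimit_shift]
  set μ : Measure ℝ := volume.restrict (Set.Ico 0 (2 * Real.pi)) with hμ
  have hpi := Real.two_pi_pos
  let D : ℝ × ℝ → ℝ := fun p => 2 + 2 / Real.sin α ^ 2 * (6 / Real.sin x ^ 2 *
    (12 + 8 * ((√|Real.sin (p.1 / 2)|)⁻¹ * (√|Real.sin (p.2 / 2)|)⁻¹)))
  have hD : Integrable D (μ.prod μ) := by
    have h1 : Integrable (fun s => (√|Real.sin (s / 2)|)⁻¹) μ := integrableOn_inv_sqrt_abs_sin_half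
    exact (integrable_const _).add ((((integrable_const _).add
      ((h1.mul_prod h1).const_mul 8)).const_mul _).const_mul _)
  have hDfin : ∫⁻ p, ENNReal.ofReal (D p) ∂(μ.prod μ) ≠ ∞ := hD.lintegral_lt_top.ne
  have hae : ∀ᵐ p ∂(μ.prod μ), (p.1 ∈ Set.Ioo 0 (2 * Real.pi) ∧
      Real.sin ((p.1 + (α + α)) / 2) ≠ 0) ∧ p.2 ∈ Set.Ioo 0 (2 * Real.pi) := by
    have h1 := Measure.quasiMeasurePreserving_fst (μ := μ) (ν := μ) |>.ae
      (ae_ne_and_sin_half_ne_zero (α + α))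
    have h2 := Measure.quasiMeasurePreserving_snd (μ := μ) (ν := μ) |>.ae
      (ae_ne_and_sin_half_ne_zero (α + α))
    filter_upwards [h1, h2] with p h1 h2 using ⟨h1, h2.1⟩
  -- Since `sin² (n α) → sin² x > 0`, the constant `3 / sin² (n α)` is eventually at most `6 / sin²
  -- x`, which makes the majorant `D` uniform.
  have hbig : ∀ᶠ i in atTop, ν i ≠ 0 ∧ Real.sin x ^ 2 / 2 < Real.sin (ν i * α) ^ 2 := by
    have hlim : Tendsto (fun i => Real.sin (y i) ^ 2) atTop (𝓝 (Real.sin x ^ 2)) :=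
      ((Real.continuous_sin.tendsto _).comp hy).pow 2
    have hx2 : 0 < Real.sin x ^ 2 := by positivity
    filter_upwards [hν.eventually_ne_atTop 0,
      hlim.eventually (lt_mem_nhds (half_lt_self hx2))] with i h0 h1
    obtain ⟨m, hm⟩ := hνy i
    exact ⟨h0, by rwa [hm, sin_sq_add_int_mul_pi]⟩
  have hbound : ∀ᶠ i in atTop, ∀ᵐ p ∂(μ.prod μ),
      dampedDensity α (ν i) (gridPoint (ν i) p.1 p.2 + α) ≤ D p := by
    filter_upwards [hbig] with i hi
    filter_upwards [hae] with p hp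
    have hx2 : 0 < Real.sin x ^ 2 := by positivity
    have hs0 : Real.sin (ν i * α) ≠ 0 := by
      intro h
      have := hi.2
      rw [h] at this
      linarith [this]
    refine (dampedDensity_gridPoint_le hα hi.1 hs0 hp.1.1 hp.2).trans ?_
    have hq : 3 / Real.sin (ν i * α) ^ 2 ≤ 6 / Real.sin x ^ 2 := by
      rw [div_le_div_iff₀ (by positivity) hx2]
      linarith [hi.2]
    simp only [D]
    gcongr
  have hlim : ∀ᵐ p ∂(μ.prod μ), Tendsto
      (fun i => dampedDensity α (ν i) (gridPoint (ν i) p.1 p.2 + α)) atTop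
      (𝓝 (dampedLimit α x (p.1 + α) (p.2 + x))) := by
    filter_upwards [hae] with p hp
    refine tendsto_dampedDensity_gridPoint hα hν hy hνy hp.2 ?_
    rw [add_assoc]; exact hp.1.2
  have hmeas : ∀ i, Measurable fun p : ℝ × ℝ =>
      ENNReal.ofReal (dampedDensity α (ν i) (gridPoint (ν i) p.1 p.2 + α)) := fun i =>
    ((measurable_dampedDensity α (ν i)).comp
      ((measurable_gridPoint (ν i)).add_const α)).ennreal_ofReal
  have hkey := tendsto_lintegral_filter_of_dominated_convergence (l := atTop)
    (fun p => ENNReal.ofReal (D p)) (Eventually.of_forall hmeas)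
    (hbound.mono fun i hi => hi.mono fun p hp => ENNReal.ofReal_le_ofReal hp) hDfin
    (hlim.mono fun p hp => (ENNReal.continuous_ofReal.tendsto _).comp hp)
  constructor
  · refine (ENNReal.Tendsto.const_mul hkey (Or.inr ENNReal.ofReal_ne_top)).congr' ?_
    filter_upwards [hν.eventually_ne_atTop 0] with i hi
    rw [lintegral_prod _ (hmeas i).aemeasurable]
    have hper : Function.Periodic (fun t => ENNReal.ofReal (dampedDensity α (ν i) t))
        (2 * Real.pi) := fun t => congrArg ENNReal.ofReal (dampedDensity_periodic α (ν i) t)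
    rw [← lintegral_Ico_add_of_periodic hpi hper α]
    rw [lintegral_Ico_eq_lintegral_lintegral hpi
      (fun t => ENNReal.ofReal (dampedDensity α (ν i) (t + α))) hi]
    rfl
  -- The majorant passes to the pointwise limit, so integrability of `ellIntegrand` needs no
  -- separate estimate.
  · refine ne_top_of_le_ne_top hDfin (lintegral_mono_ae ?_)
    obtain ⟨N, hN⟩ := eventually_atTop.1 hbound
    have hall : ∀ᵐ p ∂(μ.prod μ), ∀ i, N ≤ i →
        dampedDensity α (ν i) (gridPoint (ν i) p.1 p.2 + α) ≤ D p := by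
      rw [ae_all_iff]; intro i
      by_cases h : N ≤ i
      · exact (hN i h).mono fun p hp _ => hp
      · exact Eventually.of_forall fun p h' => absurd h' h
    filter_upwards [hlim, hall] with p h1 h2
    exact ENNReal.ofReal_le_ofReal (le_of_tendsto h1 (eventually_atTop.2 ⟨N, h2⟩))

/-! ### Assembling the limit -/

theorem restrict_Icc_prod_Icc (T : ℝ) :
    (volume : Measure (ℝ × ℝ)).restrict (Set.Icc 0 T ×ˢ Set.Icc 0 T) =
      (volume.restrict (Set.Ico 0 T)).prod (volume.restrict (Set.Ico 0 T)) := by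
  rw [Measure.volume_eq_prod, ← Measure.prod_restrict, Measure.restrict_congr_set Ico_ae_eq_Icc]

theorem dampedDensity_nonneg (α : ℝ) (n : ℕ) (t : ℝ) : 0 ≤ dampedDensity α n t :=
  mul_nonneg (dampWeight_nonneg α t) (Real.sqrt_nonneg _)

theorem dampedLimit_nonneg (α x s u : ℝ) : 0 ≤ dampedLimit α x s u :=
  mul_nonneg (dampWeight_nonneg α s) (Real.sqrt_nonneg _)

theorem lintegral_ellIntegrand {α : ℝ} (hα : Real.sin α ≠ 0) (x : ℝ) (μ : Measure (ℝ × ℝ)) :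
    ∫⁻ p, ENNReal.ofReal (ellIntegrand α x p) ∂μ =
      ∫⁻ p, ENNReal.ofReal (dampedLimit α x p.1 p.2) ∂μ +
        ∫⁻ p, ENNReal.ofReal (dampedLimit (-α) (-x) p.1 p.2) ∂μ := by
  rw [← lintegral_add_left (measurable_dampedLimit α x).ennreal_ofReal]
  refine lintegral_congr fun p => ?_
  rw [← ENNReal.ofReal_add (dampedLimit_nonneg _ _ _ _) (dampedLimit_nonneg _ _ _ _),
    dampedLimit_add_neg hα]

theorem lintegral_sqrt_angularSpeed {α : ℝ} (hα : Real.sin α ≠ 0) (n : ℕ) (μ : Measure ℝ) :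
    ∫⁻ t, ENNReal.ofReal (n / (2 * Real.pi) * √((1 + 1 / n) ^ 2 + angularSpeed α n t ^ 2)) ∂μ =
      ENNReal.ofReal (n / (2 * Real.pi)) * (∫⁻ t, ENNReal.ofReal (dampedDensity α n t) ∂μ +
        ∫⁻ t, ENNReal.ofReal (dampedDensity (-α) n t) ∂μ) := by
  have hpi := Real.pi_pos
  rw [← lintegral_add_left (measurable_dampedDensity α n).ennreal_ofReal,
    ← lintegral_const_mul' _ _ ENNReal.ofReal_ne_top]
  refine lintegral_congr fun t => ?_
  rw [← ENNReal.ofReal_add (dampedDensity_nonneg _ _ _) (dampedDensity_nonneg _ _ _),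
    dampedDensity_add_neg hα, ENNReal.ofReal_mul (by positivity)]

/-- Along a sequence of degrees `ν i → ∞` with `ν i * α → x` modulo `π`, the function
`ellIntegrand α x` is integrable and the normalised expected number of zeros of
`cosineTrigPoly α (ν i)` tends to `ell α x`. -/
theorem tendsto_lintegral_zeroCount_cosineTrigPoly {α x : ℝ} (hα : Real.sin α ≠ 0)
    (hx : Real.sin x ≠ 0) {ν : ℕ → ℕ} (hν : Tendsto ν atTop atTop) {y : ℕ → ℝ}
    (hy : Tendsto y atTop (𝓝 x)) (hνy : ∀ i, ∃ m : ℤ, ν i * α = y i + m * Real.pi) :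
    IntegrableOn (ellIntegrand α x) (Set.Icc 0 (2 * Real.pi) ×ˢ Set.Icc 0 (2 * Real.pi)) ∧
    Tendsto (fun i => (∫⁻ g, zeroCount (cosineTrigPoly α (ν i) g)
      ∂(Measure.pi fun _ : Fin 4 => gaussianReal 0 1)).toReal / ν i) atTop (𝓝 (ell α x)) := by
  have hpi := Real.pi_pos
  obtain ⟨hA, hAfin⟩ := tendsto_lintegral_dampedDensity hα hx hν hy hνy
  obtain ⟨hB, hBfin⟩ := tendsto_lintegral_dampedDensity (α := -α) (x := -x) (y := fun i => -y i)
    (by rwa [Real.sin_neg, neg_ne_zero]) (by rwa [Real.sin_neg, neg_ne_zero]) hν hy.neg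
    (fun i => by
      obtain ⟨m, hm⟩ := hνy i
      exact ⟨-m, by push_cast; linear_combination -hm⟩)
  have hell := lintegral_ellIntegrand hα x
    ((volume.restrict (Set.Ico 0 (2 * Real.pi))).prod (volume.restrict (Set.Ico 0 (2 * Real.pi))))
  have hnn : ∀ p, 0 ≤ ellIntegrand α x p := fun p => Real.sqrt_nonneg _
  have hfin : ∫⁻ p, ENNReal.ofReal (ellIntegrand α x p)
      ∂((volume.restrict (Set.Ico 0 (2 * Real.pi))).prod
        (volume.restrict (Set.Ico 0 (2 * Real.pi)))) ≠ ∞ := by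
    rw [hell]; exact ENNReal.add_ne_top.2 ⟨hAfin, hBfin⟩
  refine ⟨?_, ?_⟩
  · rw [IntegrableOn, restrict_Icc_prod_Icc]
    refine ⟨(measurable_ellIntegrand α x).aestronglyMeasurable, ?_⟩
    rw [hasFiniteIntegral_iff_ofReal (Eventually.of_forall hnn)]
    exact hfin.lt_top
  have hsum := hA.add hB
  rw [← mul_add, ← hell] at hsum
  have hreal := ((ENNReal.tendsto_toReal
    (ENNReal.mul_ne_top ENNReal.ofReal_ne_top hfin)).comp hsum).const_mul (1 / (2 * Real.pi))
  have hlim : 1 / (2 * Real.pi) * (ENNReal.ofReal (1 / (2 * Real.pi)) *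
      ∫⁻ p, ENNReal.ofReal (ellIntegrand α x p)
        ∂((volume.restrict (Set.Ico 0 (2 * Real.pi))).prod
          (volume.restrict (Set.Ico 0 (2 * Real.pi))))).toReal = ell α x := by
    rw [ell, restrict_Icc_prod_Icc, integral_eq_lintegral_of_nonneg_ae (Eventually.of_forall hnn)
      (measurable_ellIntegrand α x).aestronglyMeasurable, ENNReal.toReal_mul,
      ENNReal.toReal_ofReal (by positivity)]
    ring
  rw [hlim] at hreal
  refine hreal.congr' ?_
  have hsin : Tendsto (fun i => Real.sin (y i)) atTop (𝓝 (Real.sin x)) :=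
    (Real.continuous_sin.tendsto _).comp hy
  filter_upwards [hν.eventually_ge_atTop 2, hsin.eventually_ne hx] with i h2 hyi
  obtain ⟨m, hm⟩ := hνy i
  have hnα : Real.sin (ν i * α) ≠ 0 := by
    rw [hm, ← abs_ne_zero, abs_sin_add_int_mul_pi]; exact abs_ne_zero.2 hyi
  have hn0 : (ν i : ℝ) ≠ 0 := by
    have : ν i ≠ 0 := by omega
    exact_mod_cast this
  rw [lintegral_zeroCount_cosineTrigPoly h2 hnα, lintegral_sqrt_angularSpeed hα,
    ENNReal.toReal_mul, ENNReal.toReal_ofReal (by positivity)]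
  simp only [Function.comp_apply]
  field_simp

theorem corollary2 {Ω : Type*} [MeasurableSpace Ω] (P : Measure Ω) [IsProbabilityMeasure P]
    (α : ℝ) (hα : 0 ≤ α) (a b : ℕ → Ω → ℝ)
    (ha : IsCosineGaussian P α a) (hb : IsCosineGaussian P α b)
    (hab : IndepFun (fun ω (k : ℕ) => a (k + 1) ω) (fun ω (k : ℕ) => b (k + 1) ω) P)
    (x : ℝ) (hx : x ∈ Set.Ioo 0 Real.pi)
    (φ : ℕ → ℕ) (hφ : StrictMono φ)
    (hφx : Tendsto (fun n : ℕ => toIcoMod Real.pi_pos 0 ((φ n : ℝ) * α)) atTop (𝓝 x)) :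
    (∀ n : ℕ, 1 ≤ n →
      AEMeasurable (randomZeroCount a b n) P ∧ expectedZeros P a b n ≠ ∞) ∧
    IntegrableOn (ellIntegrand α x)
      (Set.Icc (0 : ℝ) (2 * Real.pi) ×ˢ Set.Icc (0 : ℝ) (2 * Real.pi)) ∧
    Tendsto (fun n : ℕ => |(expectedZeros P a b (φ n)).toReal / (φ n : ℝ) - ell α x|)
      atTop (𝓝 0) := by
  have hmod : ∀ i, ∃ m : ℤ,
      φ i * α = toIcoMod Real.pi_pos 0 ((φ i : ℝ) * α) + m * Real.pi := fun i =>
    ⟨toIcoDiv Real.pi_pos 0 ((φ i : ℝ) * α), by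
      rw [← zsmul_eq_mul, toIcoMod_add_toIcoDiv_zsmul]⟩
  have hsx : Real.sin x ≠ 0 := (Real.sin_pos_of_pos_of_lt_pi hx.1 hx.2).ne'
  -- If `α` were a multiple of `π`, every `φ n * α` would be too, so the limit `x` would satisfy
  -- `sin x = 0`.
  have hsα : Real.sin α ≠ 0 := by
    intro h
    obtain ⟨m, rfl⟩ := Real.sin_eq_zero_iff.1 h
    have h0 : Tendsto (fun n : ℕ => Real.sin (toIcoMod Real.pi_pos 0 ((φ n : ℝ) * (m * Real.pi))))
        atTop (𝓝 (Real.sin x)) := (Real.continuous_sin.tendsto _).comp hφx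
    refine hsx (tendsto_nhds_unique (h0.congr fun n => ?_) tendsto_const_nhds)
    obtain ⟨j, hj⟩ := hmod n
    rw [Real.sin_eq_zero_iff]
    exact ⟨φ n * m - j, by push_cast; linear_combination hj⟩
  obtain ⟨hint, hlim⟩ := tendsto_lintegral_zeroCount_cosineTrigPoly hsα hsx hφ.tendsto_atTop hφx
    hmod
  refine ⟨fun n hn => ⟨aemeasurable_randomZeroCount ha hb hsα hab n, expectedZeros_ne_top ha b hn⟩,
    hint, ?_⟩
  simp only [expectedZeros_eq_lintegral_pi ha hb hsα hab]
  simpa using (hlim.sub_const (ell α x)).abs
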